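/- All graphs are finite, simple, undirected and have at least one vertex. For a graph $G$ and $A\subseteq V(G)$ write $\overline A=V(G)\setminus A$. The cut $(A,\overline A)$ is a \emph{split} if $|A|\ge 2$, $|\overline A|\ge 2$ and all vertices of $A$ that have a neighbour in $\overline A$ have the same neighbourhood in $\overline A$. Let $\operatorname{sm}(A)=1$ if $(A,\overline A)$ is a split, and otherwise let $\operatorname{sm}(A)$ be the maximum size of a matching in the bipartite graph of the edges of $G$ between $A$ and $\overline A$. Let $\operatorname{cutrk}(A)$ be the rank over $\mathbb{F}_2$ of the $A\times\overline A$ submatrix of the adjacency matrix of $G$. A \emph{branch decomposition} of $G$ is a tree $T$ of maximum degree at most $3$ with a bijection from the leaves of $T$ to $V(G)$ (the vertex of a one-vertex tree counts as a leaf); each edge $e$ of $T$ induces the cut of $G$ given by the leaves in the two components of $T-e$. For a symmetric function $f$ on subsets of $V(G)$, the $f$-width of a branch decomposition is the maximum of $f(A)$ over the cuts $(A,\overline A)$ induced by the edges of $T$ ($0$ if $T$ has no edge). The \emph{sm-width} of $G$ is the minimum $\operatorname{sm}$-width over all branch decompositions of $G$. The \emph{clique-width} of $G$ is the least number $k$ of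 labels with which $G$ can be built by: creating a vertex with a label, disjoint union, adding all edges between the vertices with label $i$ and those with label $j$ ($i\neq j$), and changing all labels $i$ to $j$. \emph{Cographs} are the graphs obtained from one-vertex graphs by disjoint union and complementation. A graph $G$ is \emph{distance-hereditary} if distances in every connected induced subgraph are equal to those in $G$. \textbf{Proposition.} Let $G$ be a graph. \begin{enumerate} \item $G$ is a cograph if and only if its clique-width is at most two. \item If $G$ is a cograph, then its sm-width is at most one, and it is equal to one if $G$ has an edge. \item If $G$ is distance-hereditary, then its clique-width is at most three, its sm-width is at most one, and its sm-width is equal to one if $G$ has an edge. Moreover, $G$ then has a branch decomposition of $\operatorname{cutrk}$-width at most one (equal to one if $G$ has an edge) such that every cut induced by an edge of its tree and having at least two vertices on both sides is a split. \end{enumerate} -/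

import Mathlib

universe u

/-- Cographs (complement-reducible graphs): the smallest class of graphs, closed under isomorphism,
that contains the one-vertex graph and is closed under disjoint union and complementation. -/
inductive IsCograph : {V : Type u} → SimpleGraph V → Prop
  | single {V : Type u} [Unique V] (G : SimpleGraph V) : IsCograph G
  | sum {V W : Type u} {G : SimpleGraph V} {H : SimpleGraph W} :
      IsCograph G → IsCograph H → IsCograph (G.sum H)
  | compl {V : Type u} {G : SimpleGraph V} : IsCograph G → IsCograph Gᶜ
  | iso {V W : Type u} {G : SimpleGraph V} {H : SimpleGraph W} :
      G ≃g H → IsCograph G → IsCograph H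

/-- Distance-hereditary graphs: distances in every connected induced subgraph agree with the
distances in the whole graph. -/
def IsDistanceHereditary {V : Type u} (G : SimpleGraph V) : Prop :=
  ∀ S : Set V, (G.induce S).Connected →
    ∀ a b : S, (G.induce S).dist a b = G.dist (a : V) (b : V)

/-! ### Clique-width -/

/-- Clique-width expressions with `k` labels: create a vertex with label `i`; take a disjoint union;
for `i ≠ j`, add all edges between the vertices labelled `i` and those labelled `j`;
change every label `i` to `j`. -/
inductive CliqueExpr (k : ℕ) : Type
  | vertex (i : Fin k) : CliqueExpr k
  | union (s t : CliqueExpr k) : CliqueExpr k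
  | join (i j : Fin k) (hij : i ≠ j) (t : CliqueExpr k) : CliqueExpr k
  | relabel (i j : Fin k) (t : CliqueExpr k) : CliqueExpr k

namespace CliqueExpr

/-- The vertices of the labelled graph described by an expression. -/
def Verts {k : ℕ} : CliqueExpr k → Type
  | vertex _ => Unit
  | union s t => s.Verts ⊕ t.Verts
  | join _ _ _ t => t.Verts
  | relabel _ _ t => t.Verts

/-- The labelling of the vertices. -/
def label {k : ℕ} : (t : CliqueExpr k) → t.Verts → Fin k
  | vertex i => fun _ => i
  | union s t => Sum.elim s.label t.label
  | join _ _ _ t => t.label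
  | relabel i j t => fun v => if t.label v = i then j else t.label v

/-- The graph described by an expression. -/
def graph {k : ℕ} : (t : CliqueExpr k) → SimpleGraph t.Verts
  | vertex _ => (⊥ : SimpleGraph Unit)
  | union s t => s.graph.sum t.graph
  | join i j _ t =>
      t.graph ⊔ SimpleGraph.fromRel (fun a b => t.label a = i ∧ t.label b = j)
  | relabel _ _ t => t.graph

end CliqueExpr

/-- The clique-width of a graph: the least number `k` of labels such that the graph is isomorphic to
the graph described by an expression with `k` labels (`⊤` if there is none, which never happens for
a finite graph with at least one vertex). -/
noncomputable def cliqueWidth {V : Type u} (G : SimpleGraph V) : ℕ∞ :=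
  ⨅ (k : ℕ) (_ : ∃ t : CliqueExpr k, Nonempty (G ≃g t.graph)), (k : ℕ∞)

/-! ### Branch decompositions -/

/-- The leaves of a tree: the vertices of degree at most one. In a tree with at least two vertices
these are the vertices of degree one; the vertex of a one-vertex tree counts as a leaf. -/
def treeLeaves {N : Type} (T : SimpleGraph N) : Set N :=
  {x | (T.neighborSet x).encard ≤ 1}

/-- A branch decomposition over the vertex set `V`: a finite tree of maximum degree at most three
with a bijection from its leaves to `V`. -/
structure BranchDecomposition (V : Type u) where
  Node : Type
  finite_node : Finite Node
  tree : SimpleGraph Node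
  isTree : tree.IsTree
  subcubic : ∀ x, (tree.neighborSet x).encard ≤ 3
  leafEquiv : treeLeaves tree ≃ V

namespace BranchDecomposition

/-- For an edge `xy` of the tree, the elements of `V` mapped from the leaves in the component of `x`
after deletion of `xy`; the cut induced by the edge is this set with its complement. -/
def side {V : Type u} (D : BranchDecomposition V) (x y : D.Node) : Set V :=
  {v | (D.tree.deleteEdges {s(x, y)}).Reachable x (D.leafEquiv.symm v : D.Node)}

/-- The `f`-width of a branch decomposition: the maximum of `f` over the cuts induced by the edges
of the tree (`0` if the tree has no edge). -/
noncomputable def width {V : Type u} (D : BranchDecomposition V) (f : Set V → ℕ∞) : ℕ∞ :=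
  ⨆ (x : D.Node) (y : D.Node) (_ : D.tree.Adj x y), f (D.side x y)

end BranchDecomposition

/-- The `f`-width of a graph on `V`, for a cut function `f`: the minimum `f`-width of a branch
decomposition. -/
noncomputable def cutFunctionWidth {V : Type u} (f : Set V → ℕ∞) : ℕ∞ :=
  ⨅ D : BranchDecomposition V, D.width f

/-! ### Splits and split-matching-width -/

/-- The cut `(A, Aᶜ)` is a split: both sides have at least two vertices, and all vertices of `A` with
a neighbour in `Aᶜ` have the same neighbourhood in `Aᶜ`. -/
def IsSplit {V : Type u} (G : SimpleGraph V) (A : Set V) : Prop :=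
  2 ≤ A.encard ∧ 2 ≤ Aᶜ.encard ∧
    ∀ a ∈ A, ∀ b ∈ A, (G.neighborSet a ∩ Aᶜ).Nonempty → (G.neighborSet b ∩ Aᶜ).Nonempty →
      G.neighborSet a ∩ Aᶜ = G.neighborSet b ∩ Aᶜ

/-- `mm(A)`: the maximum cardinality of a matching of the bipartite graph `G[A, Aᶜ]`. -/
noncomputable def matchingCut {V : Type u} (G : SimpleGraph V) (A : Set V) : ℕ∞ :=
  ⨆ (M : (G.between A Aᶜ).Subgraph) (_ : M.IsMatching), M.edgeSet.encard

open Classical in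
/-- `sm(A)`: `1` if the cut `(A, Aᶜ)` is a split, and `mm(A)` otherwise. -/
noncomputable def splitMatchingCut {V : Type u} (G : SimpleGraph V) (A : Set V) : ℕ∞ :=
  if IsSplit G A then 1 else matchingCut G A

/-- The split-matching-width (sm-width) of a graph. -/
noncomputable def smWidth {V : Type u} (G : SimpleGraph V) : ℕ∞ :=
  cutFunctionWidth (splitMatchingCut G)

open Classical in
/-- The cut-rank of `A`: the rank over the two-element field of the `A × Aᶜ` submatrix of the
adjacency matrix. -/
noncomputable def cutRank {V : Type u} (G : SimpleGraph V) (A : Set V) : ℕ∞ :=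
  ((G.adjMatrix (ZMod 2)).submatrix (Subtype.val : A → V) (Subtype.val : (Aᶜ : Set V) → V)).eRank

/-!
Both halves of the theorem go through binary hierarchies on the vertex set: a graph is a cograph if
and only if it has a hierarchy of modules, and a distance-hereditary graph has a hierarchy of sets
whose cuts are bicliques together with isolated vertices. Reading such a hierarchy from the bottom
up gives a clique-width expression: along modules two labels suffice, and along biclique cuts it is
enough to know which vertices still lack edges, with a third label used only during a merge. Coding
the vertices by their paths from the root turns the hierarchy into a branch decomposition.

The hierarchy of a distance-hereditary graph is glued from splits of its induced subgraphs, along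
marker vertices that represent the opposite side. A split of a connected non-complete graph is found
on the last level of a breadth-first search, at a vertex `x` with as few neighbours on the previous
level as possible. Adjacent vertices of one level have the same neighbours on the previous level, so
the vertices of the last level with the same such neighbours as `x` form a module. If `x` is the
only one, then its neighbourhood is a module, by the minimality of `x`, or `x` is a pendant vertex.
-/

section CutsAndModules

variable {V : Type u} {G : SimpleGraph V} {A B : Set V}

/-- The edges between `A` and `B` form a complete bipartite graph on the vertices of `A` and of `B`
that they cover. With `B = Aᶜ` this is the condition on neighbourhoods in the definition of a split;
with an arbitrary `B` it also covers the cuts of induced subgraphs. -/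
def IsBicliqueBetween (G : SimpleGraph V) (A B : Set V) : Prop :=
  ∀ ⦃a b c d : V⦄, a ∈ A → b ∈ A → c ∈ B → d ∈ B → G.Adj a c → G.Adj b d → G.Adj a d

namespace IsBicliqueBetween

theorem symm (h : IsBicliqueBetween G A B) : IsBicliqueBetween G B A :=
  fun _ _ _ _ ha hb hc hd hac hbd => (h hd hc hb ha hbd.symm hac.symm).symm

theorem of_subsingleton_left (hA : A.Subsingleton) : IsBicliqueBetween G A B :=
  fun _ _ _ _ ha hb _ _ _ hbd => hA hb ha ▸ hbd

theorem of_subsingleton_right (hB : B.Subsingleton) : IsBicliqueBetween G A B :=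
  (of_subsingleton_left hB).symm

theorem adj_iff (h : IsBicliqueBetween G A B) {a b : V} (ha : a ∈ A) (hb : b ∈ B) :
    G.Adj a b ↔ (∃ c ∈ B, G.Adj a c) ∧ ∃ d ∈ A, G.Adj d b :=
  ⟨fun hab => ⟨⟨b, hb, hab⟩, a, ha, hab⟩,
    fun ⟨⟨_, hc, hac⟩, _, hd, hdb⟩ => h ha hd hc hb hac hdb⟩

end IsBicliqueBetween

theorem two_le_encard_iff_nontrivial : 2 ≤ A.encard ↔ A.Nontrivial := by
  rw [← Set.one_lt_encard_iff_nontrivial, ← one_add_one_eq_two, ENat.add_one_le_iff ENat.one_ne_top]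

theorem isSplit_iff_isBicliqueBetween :
    IsSplit G A ↔ A.Nontrivial ∧ Aᶜ.Nontrivial ∧ IsBicliqueBetween G A Aᶜ := by
  rw [IsSplit, two_le_encard_iff_nontrivial, two_le_encard_iff_nontrivial]
  refine and_congr_right' (and_congr_right' ⟨fun h a b c d ha hb hc hd hac hbd => ?_, ?_⟩)
  · exact ((h a ha b hb ⟨c, hac, hc⟩ ⟨d, hbd, hd⟩).symm.subset ⟨hbd, hd⟩).1
  · rintro h a ha b hb ⟨c, hac, hc⟩ ⟨d, hbd, hd⟩
    ext e
    exact ⟨fun ⟨hae, he⟩ => ⟨h hb ha hd he hbd hae, he⟩,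
      fun ⟨hbe, he⟩ => ⟨h ha hb hc he hac hbe, he⟩⟩

/-- A module: a set of vertices that no vertex outside of it distinguishes. -/
def IsModule (G : SimpleGraph V) (A : Set V) : Prop :=
  ∀ ⦃a b c : V⦄, a ∈ A → b ∈ A → c ∉ A → G.Adj a c → G.Adj b c

theorem IsModule.isBicliqueBetween (h : IsModule G A) : IsBicliqueBetween G A Aᶜ :=
  fun _ _ _ _ ha hb _ hd _ hbd => h hb ha hd hbd

end CutsAndModules

/-- A binary hierarchy on a set, that is, a laminar family with the shape of a binary tree: starting
from singletons, disjoint sets are merged until the whole set is reached, and every set arising from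
a merge has the property `P`. -/
inductive Hierarchy {V : Type u} (P : Set V → Prop) : Set V → Prop
  | single (v : V) : Hierarchy P {v}
  | union {A B : Set V} :
      Hierarchy P A → Hierarchy P B → Disjoint A B → P (A ∪ B) → Hierarchy P (A ∪ B)

namespace Hierarchy

variable {V : Type u} {W : Type*} {P Q : Set V → Prop} {S T : Set V}

theorem nonempty (h : Hierarchy P S) : S.Nonempty := by
  induction h with
  | single v => exact Set.singleton_nonempty v
  | union _ _ _ _ hA _ => exact hA.inl

theorem finite (h : Hierarchy P S) : S.Finite := by
  induction h with
  | single v => exact Set.finite_singleton v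
  | union _ _ _ _ hA hB => exact hA.union hB

theorem self (h : Hierarchy P S) (hP : ∀ v, P {v}) : P S := by
  cases h with
  | single v => exact hP v
  | union _ _ _ hAB => exact hAB

theorem mono (h : Hierarchy P S) (hPQ : ∀ R ⊆ S, P R → Q R) : Hierarchy Q S := by
  induction h with
  | single v => exact single v
  | union _ _ hAB hP hA hB =>
    exact union (hA fun R hR => hPQ R (hR.trans Set.subset_union_left))
      (hB fun R hR => hPQ R (hR.trans Set.subset_union_right)) hAB (hPQ _ subset_rfl hP)

theorem image {Q : Set W → Prop} {f : V → W} (hf : f.Injective) (h : Hierarchy P S)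
    (hPQ : ∀ R, P R → Q (f '' R)) : Hierarchy Q (f '' S) := by
  induction h with
  | single v => exact Set.image_singleton ▸ single (f v)
  | union _ _ hAB hP hA hB =>
    have hP' := hPQ _ hP
    rw [Set.image_union] at hP' ⊢
    exact union hA hB ((Set.disjoint_image_iff hf).2 hAB) hP'

theorem preimage {Q : Set W → Prop} {f : W → V} (h : Hierarchy P S)
    (hf : ∀ v ∈ S, Hierarchy Q (f ⁻¹' {v})) (hPQ : ∀ R ⊆ S, P R → Q (f ⁻¹' R)) :
    Hierarchy Q (f ⁻¹' S) := by
  induction h with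
  | single v => exact hf v rfl
  | union _ _ hAB hP hA hB =>
    exact union (hA (fun v hv => hf v (.inl hv)) fun R hR => hPQ R (hR.trans Set.subset_union_left))
      (hB (fun v hv => hf v (.inr hv)) fun R hR => hPQ R (hR.trans Set.subset_union_right))
      (hAB.preimage f) (hPQ _ subset_rfl hP)

theorem inter (h : Hierarchy P S) (hST : (S ∩ T).Nonempty) (hPQ : ∀ R, P R → Q (R ∩ T)) :
    Hierarchy Q (S ∩ T) := by
  induction h with
  | single v =>
    rw [Set.inter_eq_left.2 (Set.singleton_subset_iff.2 (Set.singleton_inter_nonempty.1 hST))]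
    exact single v
  | @union A B _ _ hAB hP hA hB =>
    have hQ := hPQ _ hP
    rw [Set.union_inter_distrib_right] at hQ hST ⊢
    rcases (A ∩ T).eq_empty_or_nonempty with hAT | hAT
    · rw [hAT, Set.empty_union] at hST ⊢
      exact hB hST
    rcases (B ∩ T).eq_empty_or_nonempty with hBT | hBT
    · rw [hBT, Set.union_empty]
      exact hA hAT
    · exact union (hA hAT) (hB hBT)
        (hAB.mono Set.inter_subset_left Set.inter_subset_left) hQ

end Hierarchy

section HierarchyOfSplits

variable {V : Type u} {G : SimpleGraph V} {A B C U : Set V} {a b z : V}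

/-- A hierarchy on `S` whose merged sets are sides of biclique cuts of the subgraph induced
by `U`. -/
abbrev BicliqueHierarchy (G : SimpleGraph V) (U S : Set V) : Prop :=
  Hierarchy (fun T => IsBicliqueBetween G T (U \ T)) S

/-- A vertex `a` of `A` that represents `A` towards `B`: it is adjacent to every vertex of `B` that
has a neighbour in `A`. -/
def IsMarker (G : SimpleGraph V) (A B : Set V) (a : V) : Prop :=
  a ∈ A ∧ ∀ ⦃u w : V⦄, u ∈ A → w ∈ B → G.Adj u w → G.Adj a w

theorem IsBicliqueBetween.exists_isMarker (h : IsBicliqueBetween G A B) (hA : A.Nonempty) :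
    ∃ a, IsMarker G A B a := by
  by_cases hcross : ∃ u ∈ A, ∃ w ∈ B, G.Adj u w
  · obtain ⟨a, ha, c, hc, hac⟩ := hcross
    exact ⟨a, ha, fun u w hu hw huw => h ha hu hc hw hac huw⟩
  · obtain ⟨a, ha⟩ := hA
    exact ⟨a, ha, fun u w hu hw huw => absurd ⟨u, hu, w, hw, huw⟩ hcross⟩

open Classical in
/-- The map contracting `A` to its element `a`: for a biclique cut `(A, B)` and a marker `a` it
pulls the cuts of the smaller graph on `B` and `a` back to cuts of the graph on `A` and `B`. -/
noncomputable def contract (A : Set V) (a : V) (x : V) : V :=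
  if x ∈ A then a else x

theorem contract_of_mem {x : V} (hx : x ∈ A) : contract A a x = a := if_pos hx

theorem contract_of_notMem {x : V} (hx : x ∉ A) : contract A a x = x := if_neg hx

theorem IsMarker.adj_contract (ha : IsMarker G A B a) {x y : V} (hx : x ∈ A ∪ B)
    (hy : y ∈ A ∪ B) (hne : contract A a x ≠ contract A a y) (hxy : G.Adj x y) :
    G.Adj (contract A a x) (contract A a y) := by
  by_cases hxA : x ∈ A <;> by_cases hyA : y ∈ A
  · exact absurd ((contract_of_mem hxA).trans (contract_of_mem hyA).symm) hne
  · rw [contract_of_mem hxA, contract_of_notMem hyA]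
    exact ha.2 hxA (hy.resolve_left hyA) hxy
  · rw [contract_of_notMem hxA, contract_of_mem hyA]
    exact (ha.2 hyA (hx.resolve_left hxA) hxy.symm).symm
  · rwa [contract_of_notMem hxA, contract_of_notMem hyA]

theorem contract_mem_insert {x : V} (hx : x ∈ A ∪ B) : contract A a x ∈ insert a B := by
  by_cases hxA : x ∈ A
  · exact .inl (contract_of_mem hxA)
  · rw [contract_of_notMem hxA]
    exact .inr (hx.resolve_left hxA)

theorem preimage_contract_subset_union (ha : a ∈ A) (hC : C ⊆ insert a B) :
    contract A a ⁻¹' C ⊆ A ∪ B := by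
  intro x hx
  by_cases hxA : x ∈ A
  · exact .inl hxA
  · rw [Set.mem_preimage, contract_of_notMem hxA] at hx
    exact (hC hx).imp_left fun hxa : x = a => hxa ▸ ha

theorem IsBicliqueBetween.preimage_contract (h : IsBicliqueBetween G A B) (ha : IsMarker G A B a)
    (hCB : C ⊆ insert a B) (hC : IsBicliqueBetween G C (insert a B \ C)) :
    IsBicliqueBetween G (contract A a ⁻¹' C) ((A ∪ B) \ contract A a ⁻¹' C) := by
  intro p q r s hp hq hr hs hpr hqs
  have hp' := preimage_contract_subset_union ha.1 hCB hp
  have hq' := preimage_contract_subset_union ha.1 hCB hq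
  have ne_of_mem {x y : V} (hx : x ∈ contract A a ⁻¹' C) (hy : y ∉ contract A a ⁻¹' C) :
      contract A a x ≠ contract A a y := fun hxy => hy (Set.mem_preimage.2 (hxy ▸ hx))
  have hps : G.Adj (contract A a p) (contract A a s) :=
    hC hp hq ⟨contract_mem_insert hr.1, hr.2⟩ ⟨contract_mem_insert hs.1, hs.2⟩
      (ha.adj_contract hp' hr.1 (ne_of_mem hp hr.2) hpr)
      (ha.adj_contract hq' hs.1 (ne_of_mem hq hs.2) hqs)
  have mem_right {x y : V} (hx : x ∈ A) (hy : y ∈ A ∪ B)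
      (hxy : contract A a x ≠ contract A a y) : y ∈ B :=
    hy.resolve_left fun hyA => hxy ((contract_of_mem hx).trans (contract_of_mem hyA).symm)
  by_cases hpA : p ∈ A
  · have hsB := mem_right hpA hs.1 (ne_of_mem hp hs.2)
    have hrB := mem_right hpA hr.1 (ne_of_mem hp hr.2)
    by_cases hsA : s ∈ A
    · exact absurd ((contract_of_mem hpA).trans (contract_of_mem hsA).symm) (ne_of_mem hp hs.2)
    · rw [contract_of_mem hpA, contract_of_notMem hsA] at hps
      exact h hpA ha.1 hrB hsB hpr hps
  · rw [contract_of_notMem hpA] at hps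
    by_cases hsA : s ∈ A
    · rw [contract_of_mem hsA] at hps
      exact (h hsA ha.1 (mem_right hsA hq' (ne_of_mem hq hs.2).symm) (hp'.resolve_left hpA)
        hqs.symm hps.symm).symm
    · rwa [contract_of_notMem hsA] at hps

theorem preimage_contract_of_subset_compl (ha : a ∈ A) (hC : C ⊆ Aᶜ) : contract A a ⁻¹' C = C := by
  ext x
  by_cases hxA : x ∈ A
  · rw [Set.mem_preimage, contract_of_mem hxA]
    exact iff_of_false (fun h => hC h ha) fun h => hC h hxA
  · rw [Set.mem_preimage, contract_of_notMem hxA]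

theorem preimage_contract_insert (ha : a ∈ A) (hC : C ⊆ Aᶜ) :
    contract A a ⁻¹' insert a C = A ∪ C := by
  rw [Set.insert_eq, Set.preimage_union, preimage_contract_of_subset_compl ha hC]
  congr 1
  ext x
  by_cases hxA : x ∈ A
  · exact iff_of_true (contract_of_mem hxA) hxA
  · rw [Set.mem_preimage, contract_of_notMem hxA]
    exact iff_of_false (fun h => hxA (Set.mem_singleton_iff.1 h ▸ ha)) hxA

theorem BicliqueHierarchy.glue (hAB : Disjoint A B) (h : IsBicliqueBetween G A B)
    (ha : IsMarker G A B a) (hb : IsMarker G B A b) (hz : z ∈ B)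
    (hA : BicliqueHierarchy G (insert b A) A)
    (hB : BicliqueHierarchy G (insert a B) (insert a B \ {z})) :
    BicliqueHierarchy G (A ∪ B) ((A ∪ B) \ {z}) := by
  have hBA : B ⊆ Aᶜ := hAB.subset_compl_left
  have hzA : z ∉ A := hBA hz
  have hroot : (A ∪ B) \ {z} = contract A a ⁻¹' (insert a B \ {z}) := by
    rw [Set.preimage_sdiff, preimage_contract_insert ha.1 hBA,
      preimage_contract_of_subset_compl ha.1 (Set.singleton_subset_iff.2 hzA)]
  rw [hroot]
  refine hB.preimage ?_ fun C hC => h.preimage_contract ha (hC.trans Set.sdiff_subset)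
  rintro v ⟨rfl | hv, -⟩
  · rw [← insert_empty_eq v, preimage_contract_insert ha.1 (Set.empty_subset _), Set.union_empty]
    refine hA.mono fun C hC hCA => ?_
    have hC' := h.symm.preimage_contract hb (hC.trans (Set.subset_insert b A)) hCA
    rwa [preimage_contract_of_subset_compl hb.1 (hC.trans hAB.subset_compl_right),
      Set.union_comm] at hC'
  · rw [preimage_contract_of_subset_compl ha.1 (Set.singleton_subset_iff.2 (hBA hv))]
    exact .single v

theorem bicliqueHierarchy_sdiff_singleton_of_ncard_le_three (hU : U.Nontrivial) (hz : z ∈ U)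
    (hcard : U.ncard ≤ 3) (hfin : U.Finite) : BicliqueHierarchy G U (U \ {z}) := by
  have hcard' := Set.ncard_sdiff_singleton_add_one hz hfin
  have hpos := Set.one_lt_ncard_iff_nontrivial_and_finite.2 ⟨hU, hfin⟩
  obtain hone | htwo : (U \ {z}).ncard = 1 ∨ (U \ {z}).ncard = 2 := by omega
  · obtain ⟨x, hx⟩ := Set.ncard_eq_one.1 hone
    exact hx ▸ .single x
  · obtain ⟨x, y, hxy, hU'⟩ := Set.ncard_eq_two.1 htwo
    have hrest : (U \ ({x} ∪ {y})).Subsingleton := by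
      rw [Set.singleton_union, ← hU', Set.sdiff_sdiff_cancel_left (Set.singleton_subset_iff.2 hz)]
      exact Set.subsingleton_singleton
    rw [hU', ← Set.singleton_union]
    exact .union (.single x) (.single y) (Set.disjoint_singleton.2 hxy)
      (.of_subsingleton_right hrest)

theorem exists_isBicliqueBetween_of_isSplit_induce {S : Set U} (hS : IsSplit (G.induce U) S)
    (hz : z ∈ U) : ∃ A B : Set V, A.Nontrivial ∧ B.Nontrivial ∧ Disjoint A B ∧ A ∪ B = U ∧
      z ∈ B ∧ IsBicliqueBetween G A B := by
  obtain ⟨hnontriv, hnontriv', hbiclique⟩ := isSplit_iff_isBicliqueBetween.1 hS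
  have hdisj : Disjoint (Subtype.val '' S) (Subtype.val '' Sᶜ) :=
    (Set.disjoint_image_iff Subtype.val_injective).2 disjoint_compl_right
  have hunion : Subtype.val '' S ∪ Subtype.val '' Sᶜ = U := by
    rw [← Set.image_union, Set.union_compl_self, Subtype.coe_image_univ]
  have hval : IsBicliqueBetween G (Subtype.val '' S) (Subtype.val '' Sᶜ) := by
    rintro _ _ _ _ ⟨a, ha, rfl⟩ ⟨b, hb, rfl⟩ ⟨c, hc, rfl⟩ ⟨d, hd, rfl⟩
    exact hbiclique ha hb hc hd
  have hS' := hnontriv.image Subtype.val_injective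
  have hSc := hnontriv'.image Subtype.val_injective
  by_cases hzS : ⟨z, hz⟩ ∈ S
  · exact ⟨_, _, hSc, hS', hdisj.symm, (Set.union_comm _ _).trans hunion, ⟨_, hzS, rfl⟩, hval.symm⟩
  · exact ⟨_, _, hS', hSc, hdisj, hunion, ⟨_, hzS, rfl⟩, hval⟩

theorem insert_ssubset_union (hAB : Disjoint A B) (hA : A.Nontrivial) (ha : a ∈ A) :
    insert a B ⊂ A ∪ B := by
  obtain ⟨c, hc, hca⟩ := hA.exists_ne a
  refine (Set.ssubset_iff_of_subset ?_).2 ⟨c, .inl hc, ?_⟩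
  · exact Set.insert_subset (.inl ha) Set.subset_union_right
  · rintro (rfl | hcB)
    · exact hca rfl
    · exact hAB.notMem_of_mem_left hc hcB

-- Leaving out an arbitrary `z` makes the induction go through: when `z` is the marker `b` of the
-- other side, the hierarchy for `insert b A` is one on `A` itself.
theorem bicliqueHierarchy_sdiff_singleton
    (hsplit : ∀ U : Set V, 4 ≤ U.ncard → ∃ A, IsSplit (G.induce U) A)
    (hfin : U.Finite) (hU : U.Nontrivial) (hz : z ∈ U) : BicliqueHierarchy G U (U \ {z}) := by
  induction hn : U.ncard using Nat.strong_induction_on generalizing U z with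
  | _ n ih =>
    subst hn
    rcases Nat.lt_or_ge 3 U.ncard with hlarge | hsmall
    swap
    · exact bicliqueHierarchy_sdiff_singleton_of_ncard_le_three hU hz hsmall hfin
    obtain ⟨S, hS⟩ := hsplit U hlarge
    obtain ⟨A, B, hA, hB, hAB, rfl, hzB, h⟩ := exists_isBicliqueBetween_of_isSplit_induce hS hz
    obtain ⟨a, ha⟩ := h.exists_isMarker hA.nonempty
    obtain ⟨b, hb⟩ := h.symm.exists_isMarker hB.nonempty
    have hsubB := insert_ssubset_union hAB hA ha.1
    have hsubA : insert b A ⊂ A ∪ B := Set.union_comm A B ▸ insert_ssubset_union hAB.symm hB hb.1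
    have hierB := ih _ (Set.ncard_lt_ncard hsubB hfin) (hfin.subset hsubB.subset)
      (hB.mono (Set.subset_insert a B)) (Set.mem_insert_of_mem a hzB) rfl
    have hierA := ih _ (Set.ncard_lt_ncard hsubA hfin) (hfin.subset hsubA.subset)
      (hA.mono (Set.subset_insert b A)) (Set.mem_insert b A) rfl
    rw [Set.insert_sdiff_self_of_notMem (hAB.notMem_of_mem_right hb.1)] at hierA
    exact .glue hAB h ha hb hzB hierA hierB

theorem hierarchy_univ_of_forall_exists_isSplit [Finite V] [Nonempty V]
    (hsplit : ∀ U : Set V, 4 ≤ U.ncard → ∃ A, IsSplit (G.induce U) A) :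
    Hierarchy (fun A => IsBicliqueBetween G A Aᶜ) Set.univ := by
  obtain ⟨z⟩ := ‹Nonempty V›
  rcases subsingleton_or_nontrivial V with _ | _
  · rw [← Subsingleton.eq_univ_of_nonempty (Set.singleton_nonempty z)]
    exact .single z
  · have hrest := bicliqueHierarchy_sdiff_singleton hsplit Set.finite_univ Set.nontrivial_univ
      (Set.mem_univ z)
    simp only [BicliqueHierarchy, ← Set.compl_eq_univ_sdiff] at hrest
    rw [← Set.compl_union_self {z}]
    refine .union hrest (.single z) disjoint_compl_left (.of_subsingleton_right ?_)
    rw [Set.compl_union_self, Set.compl_univ]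
    exact Set.subsingleton_empty

end HierarchyOfSplits

section DistanceHereditary

variable {V : Type u} {W : Type*} {G : SimpleGraph V} {H : SimpleGraph W}

theorem dist_hom_le (f : G →g H) {a b : V} (hab : G.Reachable a b) :
    H.dist (f a) (f b) ≤ G.dist a b := by
  obtain ⟨p, hp⟩ := hab.exists_walk_length_eq_dist
  rw [← hp, ← SimpleGraph.Walk.length_map f p]
  exact SimpleGraph.dist_le _

theorem exists_adj_dist_add_one_eq {r y : V} (hry : G.Reachable r y) (hne : r ≠ y) :
    ∃ q, G.Adj q y ∧ G.dist r q + 1 = G.dist r y := by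
  obtain ⟨p, hp⟩ := hry.symm.exists_walk_length_eq_dist
  rw [G.dist_comm] at hp
  cases p with
  | nil => exact absurd rfl hne
  | @cons _ q _ hyq p =>
    refine ⟨q, hyq.symm, ?_⟩
    have hq := G.dist_comm ▸ SimpleGraph.dist_le p
    have hlevel := hyq.diff_dist_adj (u := r)
    rw [SimpleGraph.Walk.length_cons] at hp
    omega

theorem connected_induce_insert {S : Set V} (hS : (G.induce S).Connected) {v w : V}
    (hw : w ∈ S) (h : G.Adj w v) : (G.induce (insert v S)).Connected := by
  rw [Set.insert_eq, Set.union_comm]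
  refine SimpleGraph.connected_induce_union hS.preconnected ?_ hw (Set.mem_singleton v) h
  rintro ⟨a, rfl⟩ ⟨b, rfl⟩
  exact SimpleGraph.Reachable.refl _

theorem exists_connected_set_dist_lt {r v : V} (h : G.Reachable r v) :
    ∃ S : Set V, (G.induce S).Connected ∧ r ∈ S ∧ v ∈ S ∧
      ∀ t ∈ S, t ≠ v → G.dist r t < G.dist r v := by
  classical
  obtain ⟨p, hp⟩ := h.exists_walk_length_eq_dist
  refine ⟨_, p.connected_induce_support, p.start_mem_support, p.end_mem_support, ?_⟩
  intro t ht htv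
  have hlength := congrArg SimpleGraph.Walk.length (p.take_spec ht)
  rw [SimpleGraph.Walk.length_append, hp] at hlength
  have htake := SimpleGraph.dist_le (p.takeUntil t ht)
  have hsuffix : (p.dropUntil t ht).length ≠ 0 := fun h0 =>
    htv (SimpleGraph.Walk.eq_of_length_eq_zero h0)
  omega

/-- The neighbours of `x` that are closer to `r` than `x`, that is, the neighbours of `x` on the
previous level of a breadth-first search from `r`. -/
def downNeighbors (G : SimpleGraph V) (r x : V) : Set V :=
  {t | G.Adj x t ∧ G.dist r t + 1 = G.dist r x}

theorem reachable_of_mem_downNeighbors {r x t : V} (ht : t ∈ downNeighbors G r x) :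
    G.Reachable r t :=
  (SimpleGraph.Reachable.of_dist_ne_zero (by have := ht.2; omega)).trans ht.1.reachable

namespace IsDistanceHereditary

variable (hG : IsDistanceHereditary G)
include hG

theorem induce (U : Set V) : IsDistanceHereditary (G.induce U) := by
  intro S hS a b
  let e : (G.induce U).induce S ≃g G.induce (Subtype.val '' S) :=
    { toEquiv := Equiv.Set.image _ S Subtype.val_injective
      map_rel_iff' := Iff.rfl }
  have hab := hS.preconnected a b
  have hS' := e.connected_iff.1 hS
  apply le_antisymm
  · calc ((G.induce U).induce S).dist a b
        = ((G.induce U).induce S).dist (e.symm (e a)) (e.symm (e b)) := by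
          simp only [e.symm_apply_apply]
      _ ≤ (G.induce (Subtype.val '' S)).dist (e a) (e b) :=
        dist_hom_le e.symm.toHom (hS'.preconnected _ _)
      _ = G.dist (a : U) (b : U) := hG _ hS' _ _
      _ ≤ (G.induce U).dist a b :=
        dist_hom_le (SimpleGraph.Embedding.induce U).toHom
          (hab.map (SimpleGraph.Embedding.induce S).toHom)
  · exact dist_hom_le (SimpleGraph.Embedding.induce S).toHom hab

theorem exists_mem_adj_dist_add_one_eq {S : Set V} (hS : (G.induce S).Connected) {r y : V}
    (hr : r ∈ S) (hy : y ∈ S) (hne : r ≠ y) :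
    ∃ q ∈ S, G.Adj q y ∧ G.dist r q + 1 = G.dist r y := by
  obtain ⟨q, hqy, hq⟩ := exists_adj_dist_add_one_eq (hS.preconnected ⟨r, hr⟩ ⟨y, hy⟩)
    (Subtype.coe_ne_coe.1 hne)
  rw [hG S hS, hG S hS] at hq
  exact ⟨q, q.2, hqy, hq⟩

theorem exists_mem_common_adj {S : Set V} (hS : (G.induce S).Connected) {x y q : V} (hx : x ∈ S)
    (hy : y ∈ S) (hne : x ≠ y) (hxy : ¬ G.Adj x y) (hxq : G.Adj x q) (hqy : G.Adj q y) :
    ∃ t ∈ S, G.Adj x t ∧ G.Adj t y := by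
  obtain ⟨t, ht, hty, hdist⟩ := hG.exists_mem_adj_dist_add_one_eq hS hx hy hne
  have htwo : G.dist x y ≤ 2 := SimpleGraph.dist_le (.cons hxq (.cons hqy .nil))
  have hxy' := (hxq.reachable.trans hqy.reachable).one_lt_dist_of_ne_of_not_adj hne hxy
  exact ⟨t, ht, SimpleGraph.dist_eq_one_iff_adj.1 (by omega), hty⟩

theorem adj_of_forall_mem_dist_ne {S : Set V} (hS : (G.induce S).Connected) {r d y : V}
    (hr : r ∈ S) (hy : y ∈ S) (hdy : G.dist r d + 1 = G.dist r y)
    (hd : ∀ t ∈ S, t ≠ d → G.dist r t ≠ G.dist r d) : G.Adj y d := by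
  have hne : r ≠ y := by rintro rfl; simp at hdy
  obtain ⟨q, hq, hqy, hdist⟩ := hG.exists_mem_adj_dist_add_one_eq hS hr hy hne
  have hqd : q = d := not_not.1 fun hqd => hd q hq hqd (by omega)
  exact hqd ▸ hqy.symm

-- When `x` and `y` are added to a shortest path from `r` to `d`, the vertex `d` remains the only
-- one on its level, so that a shortest path from `r` to `y` in this connected set goes through `d`.
theorem downNeighbors_eq_of_adj {r x y : V} (hxy : G.Adj x y) (hlevel : G.dist r x = G.dist r y) :
    downNeighbors G r x = downNeighbors G r y := by
  suffices key : ∀ {x y : V}, G.Adj x y → G.dist r x = G.dist r y →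
      downNeighbors G r x ⊆ downNeighbors G r y from
    (key hxy hlevel).antisymm (key hxy.symm hlevel.symm)
  rintro x y hxy hlevel d ⟨hxd, hd⟩
  obtain ⟨S, hS, hrS, hdS, hlt⟩ :=
    exists_connected_set_dist_lt (reachable_of_mem_downNeighbors ⟨hxd, hd⟩)
  have hS' := connected_induce_insert (connected_induce_insert hS hdS hxd.symm)
    (Set.mem_insert x S) hxy
  refine ⟨hG.adj_of_forall_mem_dist_ne hS' (by simp [hrS]) (by simp) (hlevel ▸ hd) ?_,
    hlevel ▸ hd⟩
  rintro t (rfl | rfl | ht) htd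
  · omega
  · omega
  · exact (hlt t ht htd).ne

theorem downNeighbors_eq_of_mem {r x p q : V} (hp : p ∈ downNeighbors G r x)
    (hq : q ∈ downNeighbors G r x) : downNeighbors G r p = downNeighbors G r q := by
  suffices key : ∀ {p q : V}, p ∈ downNeighbors G r x → q ∈ downNeighbors G r x →
      downNeighbors G r q ⊆ downNeighbors G r p from (key hq hp).antisymm (key hp hq)
  rintro p q ⟨hxp, hp⟩ ⟨hxq, hq⟩ d ⟨hqd, hd⟩
  obtain ⟨S, hS, hrS, hdS, hlt⟩ :=
    exists_connected_set_dist_lt (reachable_of_mem_downNeighbors ⟨hqd, hd⟩)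
  have hS' := connected_induce_insert (connected_induce_insert
    (connected_induce_insert hS hdS hqd.symm) (Set.mem_insert q S) hxq.symm)
    (Set.mem_insert x _) hxp
  have hdp : G.dist r d + 1 = G.dist r p := by omega
  refine ⟨hG.adj_of_forall_mem_dist_ne hS' (by simp [hrS]) (by simp) hdp ?_, hdp⟩
  rintro t (rfl | rfl | rfl | ht) htd
  · omega
  · omega
  · omega
  · exact (hlt t ht htd).ne

theorem isModule_downNeighbors_class {r x : V} (hmax : ∀ t, G.dist r t ≤ G.dist r x) :
    IsModule G {y | G.dist r y = G.dist r x ∧ downNeighbors G r y = downNeighbors G r x} := by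
  rintro a b c ⟨ha, hax⟩ ⟨hb, hbx⟩ hc hac
  have hlevels : G.dist r c = G.dist r a ∨ G.dist r c + 1 = G.dist r a := by
    have hca := hmax c
    have hdiff := hac.diff_dist_adj (u := r)
    omega
  rcases hlevels with hlevel | hlevel
  · exact absurd ⟨hlevel.trans ha, (hG.downNeighbors_eq_of_adj hac hlevel.symm).symm.trans hax⟩ hc
  · have hca : c ∈ downNeighbors G r a := ⟨hac, hlevel⟩
    rw [hax, ← hbx] at hca
    exact hca.1

-- Since `x` and `d` are at distance two, they have a common neighbour in the connected set of the
-- vertices `x`, `p`, `e`, `s`, `d`, and only `p` can be one.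
theorem adj_of_path_of_common_adj {x p e s d q : V} (hxp : G.Adj x p) (hpe : G.Adj p e)
    (hes : s = e ∨ G.Adj e s) (hsd : G.Adj s d) (hxq : G.Adj x q) (hqd : G.Adj q d)
    (hxe : ¬ G.Adj x e) (hxs : ¬ G.Adj x s) (hxd : ¬ G.Adj x d) (hne : x ≠ d) : G.Adj p d := by
  have hS : (G.induce {d, s, e, p, x}).Connected := by
    have hepx := connected_induce_insert (SimpleGraph.induce_pair_connected_of_adj hxp.symm)
      (Set.mem_insert p {x}) hpe
    refine connected_induce_insert ?_ (Set.mem_insert s _) hsd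
    rcases hes with rfl | hes
    · rwa [Set.insert_eq_of_mem (Set.mem_insert s _)]
    · exact connected_induce_insert hepx (Set.mem_insert e _) hes
  obtain ⟨t, ht, hxt, htd⟩ := hG.exists_mem_common_adj hS (x := x) (y := d) (by simp) (by simp)
    hne hxd hxq hqd
  rcases ht with rfl | rfl | rfl | rfl | rfl
  · exact absurd rfl htd.ne
  · exact absurd hxt hxs
  · exact absurd hxt hxe
  · exact htd
  · exact absurd rfl hxt.ne

theorem isModule_neighborSet [Finite V] {r x : V} (hr : 2 ≤ G.dist r x)
    (hmax : ∀ t, G.dist r t ≤ G.dist r x)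
    (hmin : ∀ y, G.dist r y = G.dist r x →
      (downNeighbors G r x).ncard ≤ (downNeighbors G r y).ncard)
    (hx : G.neighborSet x = downNeighbors G r x) : IsModule G (G.neighborSet x) := by
  intro q p d hxq hxp hxd hqd
  by_contra hpd
  have hdown {t : V} (hxt : G.Adj x t) : t ∈ downNeighbors G r x := hx ▸ hxt
  have hqp := hG.downNeighbors_eq_of_mem (hdown hxq) (hdown hxp)
  have hq := (hdown hxq).2
  have hp := (hdown hxp).2
  have hrp : r ≠ p := by
    rintro rfl
    rw [SimpleGraph.dist_self] at hp
    omega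
  obtain ⟨e, hep, he⟩ :=
    exists_adj_dist_add_one_eq (reachable_of_mem_downNeighbors (hdown hxp)) hrp
  have hxe : ¬ G.Adj x e := fun hxe => by have := (hdown hxe).2; omega
  have heq : e ∈ downNeighbors G r q := hqp ▸ ⟨hep.symm, he⟩
  obtain ⟨s, hds, hxs, hse⟩ : ∃ s, G.Adj d s ∧ ¬ G.Adj x s ∧ (s = e ∨ G.Adj e s) := by
    have hdmax := hmax d
    have hdiff := hqd.diff_dist_adj (u := r)
    obtain hlow | hsame | hhigh : G.dist r d + 1 = G.dist r q ∨ G.dist r q = G.dist r d ∨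
        G.dist r q + 1 = G.dist r d := by omega
    · exact absurd (hqp.subset ⟨hqd, hlow⟩).1 hpd
    · exact ⟨e, (hG.downNeighbors_eq_of_adj hqd hsame ▸ heq).1, hxe, .inl rfl⟩
    · obtain ⟨s, hs, hsx⟩ : ∃ s ∈ downNeighbors G r d, s ∉ downNeighbors G r x := by
        by_contra! hsub
        have hss : downNeighbors G r d ⊂ downNeighbors G r x :=
          (Set.ssubset_iff_of_subset hsub).2 ⟨p, hdown hxp, fun h => hpd h.1.symm⟩
        exact (hmin d (by omega)).not_gt (Set.ncard_lt_ncard hss)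
      have hqs := hG.downNeighbors_eq_of_mem (p := q) ⟨hqd.symm, hhigh⟩ hs
      exact ⟨s, hs.1, fun hxs => hsx (hdown hxs), .inr (hqs ▸ heq).1.symm⟩
  have hxd' : x ≠ d := by rintro rfl; exact hpd (G.adj_symm hxp)
  exact hpd (hG.adj_of_path_of_common_adj hxp hep.symm hse hds.symm hxq hqd hxe hxs hxd hxd')

end IsDistanceHereditary

theorem IsModule.isSplit {A : Set V} (h : IsModule G A) (hA : A.Nontrivial)
    (hAc : Aᶜ.Nontrivial) : IsSplit G A :=
  isSplit_iff_isBicliqueBetween.2 ⟨hA, hAc, h.isBicliqueBetween⟩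

theorem nontrivial_compl_pair (hcard : 4 ≤ Nat.card V) (u w : V) :
    ({u, w} : Set V)ᶜ.Nontrivial := by
  have : Finite V := Nat.finite_of_card_ne_zero (by omega)
  have hsum := Set.ncard_add_ncard_compl ({u, w} : Set V)
  have hpair := Set.ncard_insert_le u {w}
  rw [Set.ncard_singleton] at hpair
  exact Set.one_lt_ncard_iff_nontrivial.1 (by omega)

theorem isSplit_pair_of_forall_adj_eq (hcard : 4 ≤ Nat.card V) {u w : V} (hne : u ≠ w)
    (hu : ∀ t, G.Adj u t → t = w) : IsSplit G {u, w} := by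
  refine isSplit_iff_isBicliqueBetween.2
    ⟨Set.nontrivial_pair hne, nontrivial_compl_pair hcard u w, ?_⟩
  have eq_w {a c : V} (ha : a ∈ ({u, w} : Set V)) (hc : c ∈ ({u, w} : Set V)ᶜ)
      (hac : G.Adj a c) : a = w := by
    rcases ha with rfl | rfl
    · exact absurd (.inr (hu c hac)) hc
    · rfl
  intro a b c d ha hb hc hd hac hbd
  rwa [eq_w ha hc hac, ← eq_w hb hd hbd]

theorem exists_isSplit_of_not_preconnected (hcard : 4 ≤ Nat.card V) (h : ¬ G.Preconnected) :
    ∃ A, IsSplit G A := by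
  simp only [SimpleGraph.Preconnected, not_forall] at h
  obtain ⟨u, v, huv⟩ := h
  have hne : u ≠ v := by rintro rfl; exact huv (.refl _)
  by_cases hu : ∃ s, G.Adj u s
  swap
  · exact ⟨_, isSplit_pair_of_forall_adj_eq hcard hne fun t ht => absurd ⟨t, ht⟩ hu⟩
  by_cases hv : ∃ t, G.Adj v t
  swap
  · exact ⟨_, isSplit_pair_of_forall_adj_eq hcard hne.symm fun t ht => absurd ⟨t, ht⟩ hv⟩
  obtain ⟨s, hs⟩ := hu
  obtain ⟨t, ht⟩ := hv
  have hmodule : IsModule G {t | G.Reachable u t} :=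
    fun a b c ha _ hc hac => absurd (SimpleGraph.Reachable.trans ha hac.reachable) hc
  exact ⟨_, hmodule.isSplit ⟨u, .refl _, s, hs.reachable, hs.ne⟩
    ⟨v, huv, t, fun hut => huv (SimpleGraph.Reachable.trans hut ht.symm.reachable), ht.ne⟩⟩

namespace IsDistanceHereditary

variable (hG : IsDistanceHereditary G)
include hG

theorem exists_isSplit_of_two_le_dist [Finite V] (hcard : 4 ≤ Nat.card V) (hconn : G.Connected)
    {r x : V} (hr : 2 ≤ G.dist r x) (hmax : ∀ t, G.dist r t ≤ G.dist r x)
    (hmin : ∀ y, G.dist r y = G.dist r x →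
      (downNeighbors G r x).ncard ≤ (downNeighbors G r y).ncard) : ∃ A, IsSplit G A := by
  have hrx : r ≠ x := by rintro rfl; simp at hr
  by_cases hclass :
      {y | G.dist r y = G.dist r x ∧ downNeighbors G r y = downNeighbors G r x}.Nontrivial
  · have : Nontrivial V := ⟨r, x, hrx⟩
    obtain ⟨s, hrs⟩ := hconn.preconnected.exists_adj_of_nontrivial r
    refine ⟨_, (hG.isModule_downNeighbors_class hmax).isSplit hclass
      ⟨r, fun hr' => ?_, s, fun hs => ?_, hrs.ne⟩⟩
    · have := G.dist_self ▸ hr'.1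
      omega
    · have := SimpleGraph.dist_eq_one_iff_adj.2 hrs ▸ hs.1
      omega
  have hx : G.neighborSet x = downNeighbors G r x := by
    refine Set.Subset.antisymm (fun t hxt => ⟨hxt, ?_⟩) fun t ht => ht.1
    have hne : G.dist r t ≠ G.dist r x := fun hlevel => hclass
      ⟨x, ⟨rfl, rfl⟩, t, ⟨hlevel, (hG.downNeighbors_eq_of_adj hxt hlevel.symm).symm⟩, hxt.ne⟩
    have htmax := hmax t
    have hdiff := SimpleGraph.Adj.diff_dist_adj (u := r) hxt
    omega
  by_cases hN : (G.neighborSet x).Nontrivial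
  · refine ⟨_, (hG.isModule_neighborSet hr hmax hmin hx).isSplit hN
      ⟨r, fun hxr => ?_, x, G.loopless.irrefl x, hrx⟩⟩
    have := SimpleGraph.dist_eq_one_iff_adj.2 (G.adj_symm hxr)
    omega
  · obtain ⟨t, hxt⟩ : ∃ t, G.Adj x t := by
      have : Nontrivial V := ⟨r, x, hrx⟩
      exact hconn.preconnected.exists_adj_of_nontrivial x
    exact ⟨_, isSplit_pair_of_forall_adj_eq hcard hxt.ne fun s hxs =>
      Set.not_nontrivial_iff.1 hN hxs hxt⟩

theorem exists_isSplit (hcard : 4 ≤ Nat.card V) : ∃ A, IsSplit G A := by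
  have : Finite V := Nat.finite_of_card_ne_zero (by omega)
  have : Nontrivial V := Finite.one_lt_card_iff_nontrivial.1 (by omega)
  by_cases hpre : G.Preconnected
  swap
  · exact exists_isSplit_of_not_preconnected hcard hpre
  have hconn : G.Connected := ⟨hpre⟩
  by_cases hcomplete : ∀ s t, s ≠ t → G.Adj s t
  · obtain ⟨u, w, huw⟩ := exists_pair_ne V
    have hmodule : IsModule G {u, w} := fun a b c _ hb hc _ =>
      hcomplete b c fun hbc => hc (hbc ▸ hb)
    exact ⟨_, hmodule.isSplit (Set.nontrivial_pair huw) (nontrivial_compl_pair hcard u w)⟩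
  push Not at hcomplete
  obtain ⟨r, t, hrt, hnadj⟩ := hcomplete
  obtain ⟨x₀, hx₀⟩ := Finite.exists_max (G.dist r)
  obtain ⟨x, hx, hmin⟩ := Set.exists_min_image {y | G.dist r y = G.dist r x₀}
    (fun y => (downNeighbors G r y).ncard) (Set.toFinite _) ⟨x₀, rfl⟩
  have hx' : G.dist r x = G.dist r x₀ := hx
  refine hG.exists_isSplit_of_two_le_dist hcard hconn (r := r) (x := x) ?_
    (fun y => hx' ▸ hx₀ y) fun y hy => hmin y (hy.trans hx')
  exact hx' ▸ (hconn.one_lt_dist_of_ne_of_not_adj hrt hnadj).trans_le (hx₀ t)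

theorem hierarchy [Finite V] [Nonempty V] :
    Hierarchy (fun A => IsBicliqueBetween G A Aᶜ) Set.univ :=
  hierarchy_univ_of_forall_exists_isSplit fun U hU =>
    (hG.induce U).exists_isSplit (hU.trans_eq (Nat.card_coe_set_eq U).symm)

end IsDistanceHereditary

end DistanceHereditary

section Cographs

variable {V : Type u} {W : Type*} {G : SimpleGraph V} {H : SimpleGraph W} {A B S : Set V}

namespace IsModule

theorem singleton (v : V) : IsModule G {v} := by
  rintro _ _ c rfl rfl _ h
  exact h

theorem univ : IsModule G Set.univ :=
  fun _ _ c _ _ hc => absurd (Set.mem_univ c) hc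

theorem compl (h : IsModule G A) : IsModule Gᶜ A :=
  fun _ _ _ ha hb hc hac => ⟨fun hbc => hc (hbc ▸ hb), fun hbc => hac.2 (h hb ha hc hbc)⟩

theorem image_iso (e : G ≃g H) (h : IsModule G A) : IsModule H (e '' A) := by
  rintro _ _ c ⟨a, ha, rfl⟩ ⟨b, hb, rfl⟩ hc hac
  obtain ⟨c, rfl⟩ := e.surjective c
  rw [e.map_adj_iff] at hac ⊢
  exact h ha hb (fun hcA => hc ⟨c, hcA, rfl⟩) hac

theorem image_inl (h : IsModule G A) : IsModule (G.sum H) (Sum.inl '' A) := by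
  rintro _ _ (c | c) ⟨a, ha, rfl⟩ ⟨b, hb, rfl⟩ hc hac
  · exact h ha hb (fun hcA => hc ⟨c, hcA, rfl⟩) hac
  · exact absurd hac (by simp)

theorem image_inr {A : Set W} (h : IsModule H A) : IsModule (G.sum H) (Sum.inr '' A) := by
  rintro _ _ (c | c) ⟨a, ha, rfl⟩ ⟨b, hb, rfl⟩ hc hac
  · exact absurd hac (by simp)
  · exact h ha hb (fun hcA => hc ⟨c, hcA, rfl⟩) hac

theorem adj_iff_adj (hA : IsModule G A) (hB : IsModule G B) (hAB : Disjoint A B) {a b a' b' : V}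
    (ha : a ∈ A) (hb : b ∈ B) (ha' : a' ∈ A) (hb' : b' ∈ B) : G.Adj a b ↔ G.Adj a' b' := by
  suffices key : ∀ {a b a' b' : V}, a ∈ A → b ∈ B → a' ∈ A → b' ∈ B → G.Adj a b → G.Adj a' b' from
    ⟨key ha hb ha' hb', key ha' hb' ha hb⟩
  intro a b a' b' ha hb ha' hb' hab
  have hab' : G.Adj a' b := hA ha ha' (hAB.notMem_of_mem_right hb) hab
  exact (hB hb hb' (hAB.notMem_of_mem_left ha') hab'.symm).symm

end IsModule

theorem hierarchy_isModule_of_iso (e : G ≃g H) (h : Hierarchy (IsModule G) Set.univ) :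
    Hierarchy (IsModule H) Set.univ := by
  have hH := h.image e.injective fun _ => IsModule.image_iso e
  rwa [Set.image_univ, e.surjective.range_eq] at hH

theorem hierarchy_isModule_sum (hG : Hierarchy (IsModule G) Set.univ)
    (hH : Hierarchy (IsModule H) Set.univ) : Hierarchy (IsModule (G.sum H)) Set.univ := by
  have hleft := hG.image Sum.inl_injective fun _ => IsModule.image_inl (H := H)
  have hright := hH.image Sum.inr_injective fun _ => IsModule.image_inr (G := G)
  rw [Set.image_univ] at hleft hright
  rw [← Set.range_inl_union_range_inr]
  exact hleft.union hright Set.isCompl_range_inl_range_inr.disjoint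
    (Set.range_inl_union_range_inr ▸ IsModule.univ)

theorem IsCograph.hierarchy (h : IsCograph G) : Hierarchy (IsModule G) Set.univ := by
  induction h with
  | single G =>
    rw [Set.univ_unique]
    exact .single _
  | sum _ _ hG hH => exact hierarchy_isModule_sum hG hH
  | compl _ hG => exact hG.mono fun _ _ => IsModule.compl
  | iso e _ hG => exact hierarchy_isModule_of_iso e hG

theorem isCograph_induce_union_of_forall_not_adj (hAB : Disjoint A B)
    (hcross : ∀ a ∈ A, ∀ b ∈ B, ¬ G.Adj a b) (hA : IsCograph (G.induce A))
    (hB : IsCograph (G.induce B)) : IsCograph (G.induce (A ∪ B)) := by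
  classical
  refine .iso { toEquiv := (Equiv.Set.union hAB).symm, map_rel_iff' := ?_ } (hA.sum hB)
  rintro (⟨a, ha⟩ | ⟨a, ha⟩) (⟨b, hb⟩ | ⟨b, hb⟩)
  · simp
  · simpa using hcross a ha b hb
  · simpa using fun hab => hcross b hb a ha (G.adj_symm hab)
  · simp

theorem compl_induce (G : SimpleGraph V) (S : Set V) : (G.induce S)ᶜ = Gᶜ.induce S := by
  ext a b
  simp [Subtype.coe_ne_coe]

theorem isCograph_induce_union_of_forall_adj (hAB : Disjoint A B)
    (hcross : ∀ a ∈ A, ∀ b ∈ B, G.Adj a b) (hA : IsCograph (G.induce A))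
    (hB : IsCograph (G.induce B)) : IsCograph (G.induce (A ∪ B)) := by
  rw [← compl_compl (G.induce _), compl_induce]
  refine (isCograph_induce_union_of_forall_not_adj hAB (fun a ha b hb hab => ?_) ?_ ?_).compl
  · exact ((SimpleGraph.compl_adj G a b).1 hab).2 (hcross a ha b hb)
  · exact compl_induce G A ▸ hA.compl
  · exact compl_induce G B ▸ hB.compl

theorem isCograph_induce_of_hierarchy (h : Hierarchy (IsModule G) S) : IsCograph (G.induce S) := by
  induction h with
  | single v => exact .single _
  | @union A B hA hB hAB _ hA' hB' =>
    have hcross {a b a' b' : V} := (hA.self .singleton).adj_iff_adj (hB.self .singleton) hAB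
      (a := a) (b := b) (a' := a') (b' := b')
    obtain ⟨a, ha⟩ := hA.nonempty
    obtain ⟨b, hb⟩ := hB.nonempty
    by_cases hab : G.Adj a b
    · exact isCograph_induce_union_of_forall_adj hAB
        (fun a' ha' b' hb' => (hcross ha hb ha' hb').1 hab) hA' hB'
    · exact isCograph_induce_union_of_forall_not_adj hAB
        (fun a' ha' b' hb' hab' => hab ((hcross ha hb ha' hb').2 hab')) hA' hB'

theorem isCograph_iff_hierarchy : IsCograph G ↔ Hierarchy (IsModule G) Set.univ :=
  ⟨IsCograph.hierarchy,
    fun h => .iso (SimpleGraph.induceUnivIso G) (isCograph_induce_of_hierarchy h)⟩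

end Cographs

section LabelJoin

variable {V : Type u} {G : SimpleGraph V} {L : Type*} {ℓ : V → L} {i j : L}

/-- The graph obtained from `G` by adding all edges between the vertices labelled `i` and those
labelled `j`; for `i ≠ j` this is the join operation of clique-width expressions. -/
def labelJoin (G : SimpleGraph V) (ℓ : V → L) (i j : L) : SimpleGraph V :=
  G ⊔ SimpleGraph.fromRel (fun a b => ℓ a = i ∧ ℓ b = j)

theorem labelJoin_adj (hij : i ≠ j) {a b : V} :
    (labelJoin G ℓ i j).Adj a b ↔ G.Adj a b ∨ ℓ a = i ∧ ℓ b = j ∨ ℓ b = i ∧ ℓ a = j := by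
  refine or_congr_right (and_iff_right_of_imp ?_)
  rintro (⟨ha, hb⟩ | ⟨ha, hb⟩) rfl <;> exact hij (ha.symm.trans hb)

theorem isModule_labelJoin_inter (hij : i ≠ j) (hℓ : ∀ v, ℓ v = i ∨ ℓ v = j) {T : Set V}
    (hT : IsModule G T) (l : L) : IsModule (labelJoin G ℓ i j) (T ∩ {v | ℓ v = l}) := by
  rintro a b c ⟨haT, rfl⟩ ⟨hbT, hba : ℓ b = ℓ a⟩ hc hac
  rw [labelJoin_adj hij] at hac ⊢
  rw [hba]
  refine hac.elim (fun hac => ?_) .inr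
  by_cases hcT : c ∈ T
  · have hca : ℓ c ≠ ℓ a := fun hca => hc ⟨hcT, hca⟩
    rcases hℓ a with rfl | rfl
    · exact .inr (.inl ⟨rfl, (hℓ c).resolve_left hca⟩)
    · exact .inr (.inr ⟨(hℓ c).resolve_right hca, rfl⟩)
  · exact .inl (hT haT hbT hcT hac)

theorem hierarchy_isModule_labelJoin (hij : i ≠ j) (hℓ : ∀ v, ℓ v = i ∨ ℓ v = j)
    (h : Hierarchy (IsModule G) Set.univ) :
    Hierarchy (IsModule (labelJoin G ℓ i j)) Set.univ := by
  have hclass (l : L) (hl : {v | ℓ v = l}.Nonempty) :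
      Hierarchy (IsModule (labelJoin G ℓ i j)) {v | ℓ v = l} := by
    rw [← Set.univ_inter {v | ℓ v = l}] at hl ⊢
    exact h.inter hl fun _ hT => isModule_labelJoin_inter hij hℓ hT l
  have hunion : {v | ℓ v = i} ∪ {v | ℓ v = j} = Set.univ := Set.eq_univ_of_forall hℓ
  rcases {v | ℓ v = i}.eq_empty_or_nonempty with hi | hi
  · rw [hi, Set.empty_union] at hunion
    exact hunion ▸ hclass j (hunion ▸ h.nonempty)
  rcases {v | ℓ v = j}.eq_empty_or_nonempty with hj | hj
  · rw [hj, Set.union_empty] at hunion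
    exact hunion ▸ hclass i hi
  have hdisj : Disjoint {v | ℓ v = i} {v | ℓ v = j} :=
    Set.disjoint_left.2 fun v hvi hvj => hij (Eq.trans (Eq.symm hvi) hvj)
  rw [← hunion]
  exact (hclass i hi).union (hclass j hj) hdisj (hunion ▸ IsModule.univ)

end LabelJoin

namespace CliqueExpr

theorem hierarchy_isModule {k : ℕ} (hk : k ≤ 2) (t : CliqueExpr k) :
    Hierarchy (IsModule t.graph) Set.univ := by
  induction t with
  | vertex i => exact Set.univ_unique (α := Unit) ▸ .single ()
  | union s t hs ht => exact hierarchy_isModule_sum hs ht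
  | relabel _ _ _ ht => exact ht
  | join i j hij t ht =>
    refine hierarchy_isModule_labelJoin hij (fun v => ?_) ht
    have hne := Fin.val_ne_of_ne hij
    simp only [Fin.ext_iff]
    omega

end CliqueExpr

theorem cliqueWidth_le_iff {V : Type u} {G : SimpleGraph V} {n : ℕ} :
    cliqueWidth G ≤ n ↔ ∃ k ≤ n, ∃ t : CliqueExpr k, Nonempty (G ≃g t.graph) := by
  rw [← ENat.lt_add_one_iff (ENat.natCast_ne_top n), cliqueWidth, iInf_lt_iff]
  refine exists_congr fun k => ?_
  rw [iInf_lt_iff, exists_prop, and_comm, ENat.lt_add_one_iff (ENat.natCast_ne_top n), Nat.cast_le]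

theorem IsCograph.of_cliqueWidth_le_two {V : Type u} {G : SimpleGraph V}
    (h : cliqueWidth G ≤ 2) : IsCograph G := by
  obtain ⟨k, hk, t, ⟨e⟩⟩ := (cliqueWidth_le_iff (n := 2)).1 h
  exact isCograph_iff_hierarchy.2 (hierarchy_isModule_of_iso e.symm (t.hierarchy_isModule hk))

/-- The subgraph of `G` induced by `S`, labelled by `ℓ`, is described by a clique-width expression
with `k` labels. The labelling is defined on all of `V`, but only its values on `S` matter. -/
def HasCliqueExpr {V : Type u} {k : ℕ} (G : SimpleGraph V) (S : Set V) (ℓ : V → Fin k) : Prop :=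
  ∃ (t : CliqueExpr k) (f : t.Verts → V), f.Injective ∧ Set.range f = S ∧
    (∀ x y, t.graph.Adj x y ↔ G.Adj (f x) (f y)) ∧ ∀ x, t.label x = ℓ (f x)

namespace HasCliqueExpr

variable {V : Type u} {G : SimpleGraph V} {k : ℕ} {A B S : Set V} {ℓ ℓ' : V → Fin k} {i j : Fin k}

theorem singleton (v : V) : HasCliqueExpr G {v} ℓ :=
  ⟨.vertex (ℓ v), fun _ => v, fun _ _ _ => rfl, Set.range_const (ι := Unit),
    fun _ _ => iff_of_false id (G.irrefl), fun _ => rfl⟩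

theorem congr (h : HasCliqueExpr G S ℓ) (hℓ : Set.EqOn ℓ ℓ' S) : HasCliqueExpr G S ℓ' := by
  obtain ⟨t, f, hf, rfl, hadj, hlabel⟩ := h
  exact ⟨t, f, hf, rfl, hadj, fun x => (hlabel x).trans (hℓ ⟨x, rfl⟩)⟩

theorem relabel (h : HasCliqueExpr G S ℓ) (i j : Fin k) :
    HasCliqueExpr G S fun v => if ℓ v = i then j else ℓ v := by
  obtain ⟨t, f, hf, hrange, hadj, hlabel⟩ := h
  refine ⟨.relabel i j t, f, hf, hrange, hadj, fun x => ?_⟩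
  exact congrArg (fun l => if l = i then j else l) (hlabel x)

theorem union (hA : HasCliqueExpr G A ℓ) (hB : HasCliqueExpr G B ℓ) (hAB : Disjoint A B)
    (hcross : ∀ a ∈ A, ∀ b ∈ B, ¬ G.Adj a b) : HasCliqueExpr G (A ∪ B) ℓ := by
  obtain ⟨s, f, hf, rfl, hadjs, hlabels⟩ := hA
  obtain ⟨t, g, hg, rfl, hadjt, hlabelt⟩ := hB
  replace hcross x y : ¬ G.Adj (f x) (g y) := hcross _ ⟨x, rfl⟩ _ ⟨y, rfl⟩
  refine ⟨.union s t, Sum.elim f g,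
    hf.sumElim hg fun x y => hAB.ne_of_mem ⟨x, rfl⟩ ⟨y, rfl⟩, Set.Sum.elim_range f g, ?_,
    Sum.rec hlabels hlabelt⟩
  rintro (x | x) (y | y)
  · exact hadjs x y
  · simpa [CliqueExpr.graph] using hcross x y
  · simpa [CliqueExpr.graph] using fun h => hcross y x (G.adj_symm h)
  · exact hadjt x y

theorem join_union (hA : HasCliqueExpr G A ℓ) (hB : HasCliqueExpr G B ℓ) (hAB : Disjoint A B)
    (hij : i ≠ j) (hAj : ∀ a ∈ A, ℓ a ≠ j) (hBi : ∀ b ∈ B, ℓ b ≠ i)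
    (hcross : ∀ a ∈ A, ∀ b ∈ B, G.Adj a b ↔ ℓ a = i ∧ ℓ b = j) :
    HasCliqueExpr G (A ∪ B) ℓ := by
  obtain ⟨s, f, hf, rfl, hadjs, hlabels⟩ := hA
  obtain ⟨t, g, hg, rfl, hadjt, hlabelt⟩ := hB
  replace hAj x : ℓ (f x) ≠ j := hAj _ ⟨x, rfl⟩
  replace hBi y : ℓ (g y) ≠ i := hBi _ ⟨y, rfl⟩
  replace hcross x y : G.Adj (f x) (g y) ↔ ℓ (f x) = i ∧ ℓ (g y) = j :=
    hcross _ ⟨x, rfl⟩ _ ⟨y, rfl⟩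
  refine ⟨.join i j hij (.union s t), Sum.elim f g,
    hf.sumElim hg fun x y => hAB.ne_of_mem ⟨x, rfl⟩ ⟨y, rfl⟩, Set.Sum.elim_range f g, ?_,
    Sum.rec hlabels hlabelt⟩
  intro x y
  refine (labelJoin_adj (G := s.graph.sum t.graph) (ℓ := Sum.elim s.label t.label) hij).trans ?_
  rcases x with x | x <;> rcases y with y | y
  · simpa [hlabels, hAj] using hadjs x y
  · simpa [hlabels, hlabelt, hAj] using (hcross x y).symm
  · simpa [hlabels, hlabelt, hBi, hAj, G.adj_comm, and_comm] using (hcross y x).symm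
  · simpa [hlabelt, hBi] using hadjt x y

theorem cliqueWidth_le (h : HasCliqueExpr G Set.univ ℓ) : cliqueWidth G ≤ k := by
  obtain ⟨t, f, hf, hrange, hadj, -⟩ := h
  exact cliqueWidth_le_iff.2 ⟨k, le_rfl, t, ⟨SimpleGraph.Iso.symm
    ⟨.ofBijective f ⟨hf, Set.range_eq_univ.1 hrange⟩, (hadj _ _).symm⟩⟩⟩

end HasCliqueExpr

section Labellings

variable {V : Type u} {G : SimpleGraph V} {A B S T : Set V}

theorem Hierarchy.hasCliqueExpr_two (h : Hierarchy (IsModule G) S) :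
    HasCliqueExpr G S fun _ => (0 : Fin 2) := by
  induction h with
  | single v => exact .singleton v
  | @union A B hA hB hAB _ hA' hB' =>
    obtain ⟨a₀, ha₀⟩ := hA.nonempty
    obtain ⟨b₀, hb₀⟩ := hB.nonempty
    have hcross {a b} (ha : a ∈ A) (hb : b ∈ B) : G.Adj a b ↔ G.Adj a₀ b₀ :=
      (hA.self .singleton).adj_iff_adj (hB.self .singleton) hAB ha hb ha₀ hb₀
    by_cases hadj : G.Adj a₀ b₀
    · classical
      let ℓ : V → Fin 2 := fun v => if v ∈ B then 1 else 0
      have hℓA : ∀ a ∈ A, ℓ a = 0 := fun a ha => if_neg (hAB.notMem_of_mem_left ha)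
      have hℓB : ∀ b ∈ B, ℓ b = 1 := fun b hb => if_pos hb
      have hunion : HasCliqueExpr G (A ∪ B) ℓ :=
        (hA'.congr fun a ha => (hℓA a ha).symm).join_union
          ((hB'.relabel 0 1).congr fun b hb => (hℓB b hb).symm) hAB zero_ne_one
          (fun a ha => by simp [hℓA a ha]) (fun b hb => by simp [hℓB b hb])
          fun a ha b hb => iff_of_true ((hcross ha hb).2 hadj) ⟨hℓA a ha, hℓB b hb⟩
      refine (hunion.relabel 1 0).congr fun v _ => ?_
      by_cases hv : v ∈ B <;> simp [ℓ, hv]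
    · exact hA'.union hB' hAB fun a ha b hb => (hcross ha hb).not.2 hadj

theorem IsCograph.cliqueWidth_le_two (h : IsCograph G) : cliqueWidth G ≤ 2 :=
  h.hierarchy.hasCliqueExpr_two.cliqueWidth_le

/-- A vertex is active for `S` if it has a neighbour outside of `S`. When an expression has built
the subgraph induced by `S`, the active vertices of `S` are those that still lack edges. -/
def IsActive (G : SimpleGraph V) (S : Set V) (v : V) : Prop :=
  ∃ c ∉ S, G.Adj v c

open Classical in
/-- The labelling of a partially built graph: the vertices active for `S` have label `i`, and the
other ones have label `0`. -/
noncomputable def activeLabel (G : SimpleGraph V) (S : Set V) (i : Fin 3) (v : V) : Fin 3 :=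
  if IsActive G S v then i else 0

theorem activeLabel_eq_iff {i : Fin 3} (hi : i ≠ 0) {v : V} :
    activeLabel G S i v = i ↔ IsActive G S v := by
  simp [activeLabel, hi.symm]

theorem activeLabel_ne {i j : Fin 3} (hij : i ≠ j) (hj : j ≠ 0) (v : V) :
    activeLabel G S i v ≠ j := by
  unfold activeLabel
  split_ifs
  exacts [hij, hj.symm]

theorem isActive_iff_of_subset (hS : IsBicliqueBetween G S Sᶜ) (hST : S ⊆ T) {v : V} (hv : v ∈ S) :
    IsActive G T v ↔ IsActive G S v ∧ ∃ w ∈ S, IsActive G T w := by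
  constructor
  · rintro ⟨c, hc, hvc⟩
    exact ⟨⟨c, fun h => hc (hST h), hvc⟩, v, hv, c, hc, hvc⟩
  · rintro ⟨⟨c, hc, hvc⟩, w, hw, d, hd, hwd⟩
    exact ⟨d, hd, hS hv hw hc (fun h => hd (hST h)) hvc hwd⟩

theorem adj_iff_isActive_and_isActive (hA : IsBicliqueBetween G A Aᶜ)
    (hB : IsBicliqueBetween G B Bᶜ) (hAB : Disjoint A B) {a₀ b₀ a b : V} (ha₀ : a₀ ∈ A)
    (hb₀ : b₀ ∈ B) (hadj : G.Adj a₀ b₀) (ha : a ∈ A) (hb : b ∈ B) :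
    G.Adj a b ↔ IsActive G A a ∧ IsActive G B b := by
  have hBA {b} (hb : b ∈ B) : b ∉ A := hAB.notMem_of_mem_right hb
  have hA' {a} (ha : a ∈ A) : a ∉ B := hAB.notMem_of_mem_left ha
  refine ⟨fun hab => ⟨⟨b, hBA hb, hab⟩, a, hA' ha, hab.symm⟩, ?_⟩
  rintro ⟨⟨c, hc, hac⟩, d, hd, hbd⟩
  have hab₀ : G.Adj a b₀ := hA ha ha₀ hc (hBA hb₀) hac hadj
  exact (hB hb hb₀ hd (hA' ha) hbd hab₀.symm).symm

theorem HasCliqueExpr.union_of_activeLabel {ℓ : V → Fin 3} (hA : IsBicliqueBetween G A Aᶜ)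
    (hB : IsBicliqueBetween G B Bᶜ) (hAB : Disjoint A B) (hexprA : HasCliqueExpr G A ℓ)
    (hexprB : HasCliqueExpr G B ℓ) (hℓA : Set.EqOn ℓ (activeLabel G A 1) A)
    (hℓB : Set.EqOn ℓ (activeLabel G B 2) B) : HasCliqueExpr G (A ∪ B) ℓ := by
  by_cases hcross : ∃ a₀ ∈ A, ∃ b₀ ∈ B, G.Adj a₀ b₀
  · obtain ⟨a₀, ha₀, b₀, hb₀, hadj⟩ := hcross
    refine hexprA.join_union hexprB hAB (i := 1) (j := 2) (by decide) (fun a ha => ?_)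
      (fun b hb => ?_) fun a ha b hb => ?_
    · exact hℓA ha ▸ activeLabel_ne (by decide) (by decide) a
    · exact hℓB hb ▸ activeLabel_ne (by decide) (by decide) b
    · rw [hℓA ha, hℓB hb, activeLabel_eq_iff (by decide), activeLabel_eq_iff (by decide)]
      exact adj_iff_isActive_and_isActive hA hB hAB ha₀ hb₀ hadj ha hb
  · push Not at hcross
    exact hexprA.union hexprB hAB hcross

theorem Hierarchy.hasCliqueExpr_activeLabel
    (h : Hierarchy (fun A => IsBicliqueBetween G A Aᶜ) S) :
    HasCliqueExpr G S (activeLabel G S 1) := by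
  classical
  induction h with
  | single v => exact .singleton v
  | @union A B hA hB hAB _ hA' hB' =>
    have hbicliqueA := hA.self fun v => .of_subsingleton_left Set.subsingleton_singleton
    have hbicliqueB := hB.self fun v => .of_subsingleton_left Set.subsingleton_singleton
    let ℓ : V → Fin 3 := fun v => if v ∈ B then activeLabel G B 2 v else activeLabel G A 1 v
    have hℓA : Set.EqOn ℓ (activeLabel G A 1) A := fun a ha => if_neg (hAB.notMem_of_mem_left ha)
    have hℓB : Set.EqOn ℓ (activeLabel G B 2) B := fun b hb => if_pos hb
    have hexprB : HasCliqueExpr G B (activeLabel G B 2) := by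
      refine (hB'.relabel 1 2).congr fun b _ => ?_
      by_cases hb : IsActive G B b <;> simp [activeLabel, hb]
    have hexpr : HasCliqueExpr G (A ∪ B) ℓ := .union_of_activeLabel hbicliqueA hbicliqueB hAB
      (hA'.congr hℓA.symm) (hexprB.congr hℓB.symm) hℓA hℓB
    -- After the merge, the active vertices of each part either all stay active or all become
    -- inactive.
    let keep (C : Set V) : Fin 3 := if ∃ w ∈ C, IsActive G (A ∪ B) w then 1 else 0
    refine ((hexpr.relabel 1 (keep A)).relabel 2 (keep B)).congr fun v hv => ?_
    rcases hv with hv | hv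
    · simp only [hℓA hv, activeLabel,
        isActive_iff_of_subset hbicliqueA Set.subset_union_left hv, keep]
      by_cases hactive : IsActive G A v <;>
        by_cases hkeep : ∃ w ∈ A, IsActive G (A ∪ B) w <;> simp [hactive, hkeep]
    · simp only [hℓB hv, activeLabel,
        isActive_iff_of_subset hbicliqueB Set.subset_union_right hv, keep]
      by_cases hactive : IsActive G B v <;>
        by_cases hkeep : ∃ w ∈ B, IsActive G (A ∪ B) w <;> simp [hactive, hkeep]

theorem IsDistanceHereditary.cliqueWidth_le_three [Finite V] [Nonempty V]
    (h : IsDistanceHereditary G) : cliqueWidth G ≤ 3 :=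
  h.hierarchy.hasCliqueExpr_activeLabel.cliqueWidth_le

end Labellings

/-- The words `code v` for `v ∈ S` are the leaves of a full binary tree of words, in which the root
is the empty word and the children of `w` are `true :: w` and `false :: w`. Its nodes are the
suffixes of the words `code v`, so a word is read from its last letter on. -/
structure IsFullSuffixCode {V : Type u} (S : Set V) (code : V → List Bool) : Prop where
  eq_of_suffix : ∀ v ∈ S, ∀ w ∈ S, code v <:+ code w → v = w
  full : ∀ b l, ∀ v ∈ S, b :: l <:+ code v → ∃ w ∈ S, (!b) :: l <:+ code w

section HierarchyToCode

variable {V : Type u} {P : Set V → Prop} {A B S : Set V}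

open Classical in
/-- The code of a union whose two parts are coded by `c` and `d`, as the children of a new root. -/
noncomputable def mergeCode (A : Set V) (c d : V → List Bool) (v : V) : List Bool :=
  if v ∈ A then c v ++ [true] else d v ++ [false]

theorem append_true_suffix_mergeCode_iff {c d : V → List Bool} {l : List Bool} {v : V} :
    l ++ [true] <:+ mergeCode A c d v ↔ v ∈ A ∧ l <:+ c v := by
  unfold mergeCode
  split_ifs with hv <;> simp [hv, List.suffix_concat_iff]

theorem append_false_suffix_mergeCode_iff {c d : V → List Bool} {l : List Bool} {v : V} :
    l ++ [false] <:+ mergeCode A c d v ↔ v ∉ A ∧ l <:+ d v := by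
  unfold mergeCode
  split_ifs with hv <;> simp [hv, List.suffix_concat_iff]

theorem mergeCode_of_mem {c d : V → List Bool} {v : V} (hv : v ∈ A) :
    mergeCode A c d v = c v ++ [true] :=
  if_pos hv

theorem mergeCode_of_notMem {c d : V → List Bool} {v : V} (hv : v ∉ A) :
    mergeCode A c d v = d v ++ [false] :=
  if_neg hv

theorem IsFullSuffixCode.union {c d : V → List Bool} (hc : IsFullSuffixCode A c)
    (hd : IsFullSuffixCode B d) (hA : A.Nonempty) (hB : B.Nonempty) (hAB : Disjoint A B) :
    IsFullSuffixCode (A ∪ B) (mergeCode A c d) where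
  eq_of_suffix v hv w hw h := by
    by_cases hvA : v ∈ A
    · rw [mergeCode_of_mem hvA, append_true_suffix_mergeCode_iff] at h
      exact hc.eq_of_suffix v hvA w h.1 h.2
    · rw [mergeCode_of_notMem hvA, append_false_suffix_mergeCode_iff] at h
      exact hd.eq_of_suffix v (hv.resolve_left hvA) w (hw.resolve_left h.1) h.2
  full b l v hv h := by
    have hBA {w : V} (hw : w ∈ B) : w ∉ A := hAB.notMem_of_mem_right hw
    rcases List.eq_nil_or_concat' l with rfl | ⟨l, e, rfl⟩
    · obtain ⟨a, ha⟩ := hA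
      obtain ⟨a', ha'⟩ := hB
      cases b
      · exact ⟨a, .inl ha, append_true_suffix_mergeCode_iff.2 ⟨ha, List.nil_suffix⟩⟩
      · exact ⟨a', .inr ha', append_false_suffix_mergeCode_iff.2 ⟨hBA ha', List.nil_suffix⟩⟩
    · rw [← List.cons_append] at h
      simp only [← List.cons_append]
      cases e
      · rw [append_false_suffix_mergeCode_iff] at h
        obtain ⟨w, hw, hsuffix⟩ := hd.full b l v (hv.resolve_left h.1) h.2
        exact ⟨w, .inr hw, append_false_suffix_mergeCode_iff.2 ⟨hBA hw, hsuffix⟩⟩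
      · rw [append_true_suffix_mergeCode_iff] at h
        obtain ⟨w, hw, hsuffix⟩ := hc.full b l v h.1 h.2
        exact ⟨w, .inl hw, append_true_suffix_mergeCode_iff.2 ⟨hw, hsuffix⟩⟩

theorem Hierarchy.exists_isFullSuffixCode (h : Hierarchy P S) (hP : ∀ v, P {v}) :
    ∃ code, IsFullSuffixCode S code ∧
      ∀ l, ∀ v ∈ S, l <:+ code v → P {w ∈ S | l <:+ code w} := by
  induction h with
  | single v =>
    refine ⟨fun _ => [], ⟨?_, ?_⟩, ?_⟩
    · rintro _ rfl _ rfl _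
      rfl
    · simp
    · rintro l _ rfl hl
      simpa [List.suffix_nil.1 hl] using hP _
  | @union A B hA hB hAB hunion hA' hB' =>
    obtain ⟨c, hc, hPc⟩ := hA'
    obtain ⟨d, hd, hPd⟩ := hB'
    refine ⟨mergeCode A c d, hc.union hd hA.nonempty hB.nonempty hAB, fun l v hv hl => ?_⟩
    rcases List.eq_nil_or_concat' l with rfl | ⟨l, b, rfl⟩
    · rwa [Set.sep_eq_self_iff_mem_true.2 fun _ _ => List.nil_suffix]
    cases b
    · rw [append_false_suffix_mergeCode_iff] at hl
      convert hPd l v (hv.resolve_left hl.1) hl.2 using 1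
      ext w
      have : w ∈ B → w ∉ A := fun hw => hAB.notMem_of_mem_right hw
      simp only [append_false_suffix_mergeCode_iff, Set.mem_ofPred_eq, Set.mem_union]
      tauto
    · rw [append_true_suffix_mergeCode_iff] at hl
      convert hPc l v hl.1 hl.2 using 1
      ext w
      simp only [append_true_suffix_mergeCode_iff, Set.mem_ofPred_eq, Set.mem_union]
      tauto

end HierarchyToCode

section CodeTree

variable {V : Type u} {code : V → List Bool}

/-- The nodes of the tree of a code. -/
def codeNodes (code : V → List Bool) : Set (List Bool) :=
  {l | ∃ v, l <:+ code v}

theorem codeNodes_of_suffix {l m : List Bool} (hlm : l <:+ m) (hm : m ∈ codeNodes code) :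
    l ∈ codeNodes code :=
  hm.imp fun _ => hlm.trans

theorem finite_codeNodes [Finite V] : (codeNodes code).Finite := by
  refine (Set.finite_iUnion fun v => (code v).tails.finite_toSet).subset ?_
  rintro l ⟨v, hv⟩
  exact Set.mem_iUnion.2 ⟨v, (List.mem_tails _ _).2 hv⟩

/-- The rooted tree of a code, as a graph. -/
def codeTree (code : V → List Bool) : SimpleGraph (codeNodes code) where
  Adj x y := (∃ b, x.1 = b :: y.1) ∨ ∃ b, y.1 = b :: x.1
  symm := ⟨fun _ _ => Or.symm⟩
  loopless := ⟨fun _ h => h.elim (fun ⟨_, h⟩ => List.cons_ne_self _ _ h.symm)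
    fun ⟨_, h⟩ => List.cons_ne_self _ _ h.symm⟩

theorem encard_neighborSet_codeTree_le (x : codeNodes code) :
    ((codeTree code).neighborSet x).encard ≤ 3 := by
  have hsub : Subtype.val '' (codeTree code).neighborSet x ⊆
      {x.1.tail, true :: x.1, false :: x.1} := by
    rintro _ ⟨y, ⟨b, h⟩ | ⟨b, h⟩, rfl⟩
    · simp [h]
    · cases b <;> simp [h]
  rw [← Subtype.val_injective.encard_image]
  calc (Subtype.val '' (codeTree code).neighborSet x).encard
    _ ≤ ({x.1.tail, true :: x.1, false :: x.1} : Set (List Bool)).encard :=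
      Set.encard_le_encard hsub
    _ ≤ ({false :: x.1} : Set (List Bool)).encard + 1 + 1 :=
      (Set.encard_insert_le _ _).trans (by gcongr; exact Set.encard_insert_le _ _)
    _ = 3 := by rw [Set.encard_singleton]; norm_num

theorem reachable_of_suffix {H : SimpleGraph (codeNodes code)} {r q : codeNodes code}
    (hrq : r.1 <:+ q.1)
    (hH : ∀ s t : codeNodes code, ∀ c, t.1 = c :: s.1 → r.1 <:+ s.1 → t.1 <:+ q.1 → H.Adj s t) :
    H.Reachable r q := by
  obtain ⟨l, hl⟩ := q
  induction l with
  | nil =>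
    obtain rfl : r = ⟨[], hl⟩ := Subtype.ext (List.suffix_nil.1 hrq)
    rfl
  | cons c l ih =>
    rcases List.suffix_cons_iff.1 hrq with h | h
    · obtain rfl : r = ⟨c :: l, hl⟩ := Subtype.ext h
      rfl
    · have hl' : l ∈ codeNodes code := codeNodes_of_suffix (List.suffix_cons c l) hl
      have hparent : H.Reachable r ⟨l, hl'⟩ := ih hl' h fun s t e hst hs ht =>
        hH s t e hst hs (ht.trans (List.suffix_cons c l))
      exact hparent.trans (hH ⟨l, hl'⟩ ⟨c :: l, hl⟩ c rfl h List.suffix_rfl).reachable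

section Edge

variable {x y p q : codeNodes code} {b : Bool}

theorem not_suffix_parent (hy : y.1 = b :: x.1) : ¬ y.1 <:+ x.1 := fun h => by
  simpa [hy] using h.length_le

theorem deleteEdges_adj_child_iff (hy : y.1 = b :: x.1) {c : Bool} (hq : q.1 = c :: p.1) :
    ((codeTree code).deleteEdges {s(x, y)}).Adj p q ↔ q ≠ y := by
  rw [SimpleGraph.deleteEdges_adj, Set.mem_singleton_iff, Sym2.eq_iff]
  refine ⟨fun h hqy => h.2 (.inl ⟨Subtype.ext ?_, hqy⟩), fun hqy => ⟨.inr ⟨c, hq⟩, ?_⟩⟩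
  · exact (List.cons.inj (hq.symm.trans (hqy ▸ hy))).2
  · rintro (⟨-, rfl⟩ | ⟨rfl, rfl⟩)
    · exact hqy rfl
    · exact not_suffix_parent hy (hq ▸ List.suffix_cons _ _)

theorem suffix_iff_suffix_of_reachable (hy : y.1 = b :: x.1)
    (h : ((codeTree code).deleteEdges {s(x, y)}).Reachable p q) : y.1 <:+ p.1 ↔ y.1 <:+ q.1 := by
  have hchild {p q : codeNodes code} {c : Bool} (hq : q.1 = c :: p.1)
      (hpq : ((codeTree code).deleteEdges {s(x, y)}).Adj p q) : y.1 <:+ p.1 ↔ y.1 <:+ q.1 := by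
    have hqy : y.1 ≠ q.1 := fun h =>
      (deleteEdges_adj_child_iff hy hq).1 hpq (Subtype.ext h.symm)
    rw [hq] at hqy ⊢
    rw [List.suffix_cons_iff, or_iff_right hqy]
  obtain ⟨w⟩ := h
  induction w with
  | nil => rfl
  | cons hpq _ ih =>
    refine Iff.trans ?_ ih
    rcases hpq.1 with ⟨c, hc⟩ | ⟨c, hc⟩
    · exact (hchild hc hpq.symm).symm
    · exact hchild hc hpq

theorem reachable_child_iff (hy : y.1 = b :: x.1) :
    ((codeTree code).deleteEdges {s(x, y)}).Reachable y q ↔ y.1 <:+ q.1 := by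
  refine ⟨fun h => (suffix_iff_suffix_of_reachable hy h).1 List.suffix_rfl, fun h => ?_⟩
  refine reachable_of_suffix h fun s t c ht hs _ => (deleteEdges_adj_child_iff hy ht).2 ?_
  rintro rfl
  exact not_suffix_parent ht hs

theorem reachable_parent_iff (hy : y.1 = b :: x.1) :
    ((codeTree code).deleteEdges {s(x, y)}).Reachable x q ↔ ¬ y.1 <:+ q.1 := by
  refine ⟨fun h => (suffix_iff_suffix_of_reachable hy h).not.1 (not_suffix_parent hy), fun h => ?_⟩
  let root : codeNodes code := ⟨[], codeNodes_of_suffix List.nil_suffix x.2⟩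
  have hroot {q : codeNodes code} (hq : ¬ y.1 <:+ q.1) :
      ((codeTree code).deleteEdges {s(x, y)}).Reachable root q := by
    refine reachable_of_suffix List.nil_suffix fun s t c ht _ htq =>
      (deleteEdges_adj_child_iff hy ht).2 ?_
    rintro rfl
    exact hq htq
  exact (hroot (not_suffix_parent hy)).symm.trans (hroot h)

end Edge

theorem isTree_codeTree [Nonempty V] : (codeTree code).IsTree where
  connected := by
    let root : codeNodes code := ⟨[], Classical.arbitrary V, List.nil_suffix⟩
    have hroot (q : codeNodes code) : (codeTree code).Reachable root q :=
      reachable_of_suffix List.nil_suffix fun _ _ c ht _ _ => .inr ⟨c, ht⟩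
    have : Nonempty (codeNodes code) := ⟨root⟩
    exact ⟨fun p q => (hroot p).symm.trans (hroot q)⟩
  isAcyclic := by
    rw [SimpleGraph.isAcyclic_iff_forall_adj_isBridge]
    have hbridge {x y : codeNodes code} {b : Bool} (hy : y.1 = b :: x.1) :
        (codeTree code).IsBridge s(x, y) := by
      rw [SimpleGraph.isBridge_iff, reachable_parent_iff hy, not_not]
    rintro x y (⟨b, hx⟩ | ⟨b, hy⟩)
    · exact Sym2.eq_swap ▸ hbridge hx
    · exact hbridge hy

/-- The leaf of the tree of a code that belongs to `v`. -/
def codeLeaf (code : V → List Bool) (v : V) : codeNodes code :=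
  ⟨code v, v, List.suffix_rfl⟩

theorem IsFullSuffixCode.injective_codeLeaf (h : IsFullSuffixCode Set.univ code) :
    (codeLeaf code).Injective :=
  fun v w hvw => h.eq_of_suffix v trivial w trivial ⟨[], congrArg Subtype.val hvw⟩

theorem IsFullSuffixCode.treeLeaves_codeTree (h : IsFullSuffixCode Set.univ code) :
    treeLeaves (codeTree code) = Set.range (codeLeaf code) := by
  ext x
  rw [treeLeaves, Set.mem_ofPred_eq, Set.encard_le_one_iff_subsingleton]
  constructor
  · intro hx
    obtain ⟨l, v, hv⟩ := x
    obtain ⟨t, ht⟩ := id hv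
    rcases List.eq_nil_or_concat' t with rfl | ⟨t, b, rfl⟩
    · exact ⟨v, Subtype.ext ht.symm⟩
    · have hb : b :: l <:+ code v := ⟨t, by simpa using ht⟩
      obtain ⟨w, -, hw⟩ := h.full b l v trivial hb
      have heq : (⟨b :: l, v, hb⟩ : codeNodes code) = ⟨(!b) :: l, w, hw⟩ :=
        hx (.inr ⟨b, rfl⟩) (.inr ⟨!b, rfl⟩)
      exact absurd (List.cons.inj (Subtype.ext_iff.1 heq)).1 (Bool.self_ne_not b)
  · rintro ⟨v, rfl⟩
    have hparent (y : codeNodes code) (hy : (codeTree code).Adj (codeLeaf code v) y) :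
        ∃ b, code v = b :: y.1 := by
      refine hy.resolve_right ?_
      rintro ⟨b, hb⟩
      obtain ⟨w, hw⟩ := y.2
      have hvw : v = w := h.eq_of_suffix v trivial w trivial ((hb ▸ List.suffix_cons _ _).trans hw)
      exact absurd (hvw ▸ hw) (not_suffix_parent hb)
    intro y hy z hz
    obtain ⟨b, hb⟩ := hparent y hy
    obtain ⟨c, hc⟩ := hparent z hz
    exact Subtype.ext (List.cons.inj (hb.symm.trans hc)).2

/-- The branch decomposition given by the tree of a full suffix code. -/
noncomputable def IsFullSuffixCode.branchDecomposition [Finite V] [Nonempty V]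
    (h : IsFullSuffixCode Set.univ code) : BranchDecomposition V where
  Node := codeNodes code
  finite_node := finite_codeNodes
  tree := codeTree code
  isTree := isTree_codeTree
  subcubic := encard_neighborSet_codeTree_le
  leafEquiv := (Equiv.setCongr h.treeLeaves_codeTree).trans
    (Equiv.ofInjective _ h.injective_codeLeaf).symm

theorem IsFullSuffixCode.side_branchDecomposition [Finite V] [Nonempty V]
    (h : IsFullSuffixCode Set.univ code) {x y : codeNodes code} (hxy : (codeTree code).Adj x y) :
    h.branchDecomposition.side x y = {v | x.1 <:+ code v} ∨
      h.branchDecomposition.side x y = {v | y.1 <:+ code v}ᶜ := by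
  rcases hxy with ⟨b, hb⟩ | ⟨b, hb⟩
  · left
    ext v
    exact (Sym2.eq_swap ▸ reachable_child_iff (q := codeLeaf code v) hb :)
  · right
    ext v
    exact reachable_parent_iff (q := codeLeaf code v) hb

end CodeTree

theorem Hierarchy.exists_branchDecomposition {V : Type u} {P : Set V → Prop}
    (h : Hierarchy P Set.univ) (hP : ∀ v, P {v}) :
    ∃ D : BranchDecomposition V,
      ∀ x y, D.tree.Adj x y → P (D.side x y) ∨ P (D.side x y)ᶜ := by
  have : Finite V := Set.finite_univ_iff.1 h.finite
  have : Nonempty V := Set.nonempty_iff_univ_nonempty.2 h.nonempty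
  obtain ⟨code, hcode, hPcode⟩ := h.exists_isFullSuffixCode hP
  have hnode (x : codeNodes code) : P {v | x.1 <:+ code v} := by
    obtain ⟨v, hv⟩ := x.2
    simpa using hPcode x.1 v trivial hv
  refine ⟨hcode.branchDecomposition, fun x y hxy => ?_⟩
  rcases hcode.side_branchDecomposition hxy with hside | hside
  · exact .inl (hside ▸ hnode x)
  · exact .inr (by rw [hside, compl_compl]; exact hnode y)

section CutFunctions

variable {V : Type u} {G : SimpleGraph V} {A : Set V}

theorem matchingCut_compl : matchingCut G Aᶜ = matchingCut G A := by
  rw [matchingCut, matchingCut, compl_compl, SimpleGraph.between_comm]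

theorem matchingCut_le_one_of_subsingleton (hA : A.Subsingleton) : matchingCut G A ≤ 1 := by
  refine iSup₂_le fun M hM => Set.encard_le_one_iff.2 ?_
  have hends : ∀ e ∈ M.edgeSet, ∃ a ∈ A, ∃ b, e = s(a, b) ∧ M.Adj a b := by
    intro e
    induction e with
    | _ a b =>
      intro (hab : M.Adj a b)
      rcases (M.adj_sub hab).2 with ⟨ha, -⟩ | ⟨-, hb⟩
      · exact ⟨a, ha, b, rfl, hab⟩
      · exact ⟨b, hb, a, Sym2.eq_swap, hab.symm⟩
  intro e f he hf
  obtain ⟨a, ha, b, rfl, hab⟩ := hends e he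
  obtain ⟨a', ha', b', rfl, hab'⟩ := hends f hf
  obtain rfl := hA ha ha'
  rw [hM.eq_of_adj_left hab hab']

theorem one_le_matchingCut {a b : V} (ha : a ∈ A) (hb : b ∉ A) (hab : G.Adj a b) :
    1 ≤ matchingCut G A := by
  have hcross : (G.between A Aᶜ).Adj a b := ⟨hab, .inl ⟨ha, hb⟩⟩
  refine le_trans ?_ (le_iSup₂_of_le ((G.between A Aᶜ).subgraphOfAdj hcross)
    (SimpleGraph.Subgraph.IsMatching.subgraphOfAdj hcross) le_rfl)
  simp

theorem IsBicliqueBetween.splitMatchingCut_le_one (h : IsBicliqueBetween G A Aᶜ) :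
    splitMatchingCut G A ≤ 1 := by
  rw [splitMatchingCut]
  split_ifs with hsplit
  · exact le_rfl
  rcases A.subsingleton_or_nontrivial with hA | hA
  · exact matchingCut_le_one_of_subsingleton hA
  rcases Aᶜ.subsingleton_or_nontrivial with hA' | hA'
  · exact matchingCut_compl ▸ matchingCut_le_one_of_subsingleton hA'
  · exact absurd (isSplit_iff_isBicliqueBetween.2 ⟨hA, hA', h⟩) hsplit

theorem one_le_splitMatchingCut {a b : V} (ha : a ∈ A) (hb : b ∉ A) (hab : G.Adj a b) :
    1 ≤ splitMatchingCut G A := by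
  rw [splitMatchingCut]
  split_ifs
  · exact le_rfl
  · exact one_le_matchingCut ha hb hab

theorem eRank_vecMulVec_le_one {R m n : Type*} [CommSemiring R] [StrongRankCondition R]
    (w : m → R) (v : n → R) : (Matrix.vecMulVec w v).eRank ≤ 1 := by
  have hspan : Submodule.span R (Set.range (Matrix.vecMulVec w v).col) ≤ Submodule.span R {w} := by
    rw [Submodule.span_le, Set.range_subset_iff]
    refine fun j => Submodule.mem_span_singleton.2 ⟨v j, funext fun i => ?_⟩
    exact mul_comm (v j) (w i)
  have hrank := (Submodule.rank_mono hspan).trans (rank_span_le _)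
  rw [Cardinal.mk_singleton] at hrank
  exact (Cardinal.toENat.monotone' hrank).trans_eq (by simp)

open Classical in
theorem IsBicliqueBetween.cutRank_le_one (h : IsBicliqueBetween G A Aᶜ) : cutRank G A ≤ 1 := by
  let w : A → ZMod 2 := fun a => if ∃ c ∈ Aᶜ, G.Adj a c then 1 else 0
  let v : (Aᶜ : Set V) → ZMod 2 := fun b => if ∃ d ∈ A, G.Adj d b then 1 else 0
  have hmatrix : (G.adjMatrix (ZMod 2)).submatrix Subtype.val Subtype.val =
      Matrix.vecMulVec w v := by
    ext a b
    rw [Matrix.submatrix_apply, SimpleGraph.adjMatrix_apply, Matrix.vecMulVec_apply,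
      if_congr (h.adj_iff a.2 b.2) rfl rfl]
    simp only [w, v, mul_ite, mul_one, mul_zero, ite_and]
    split_ifs <;> rfl
  exact (congrArg Matrix.eRank hmatrix).trans_le (eRank_vecMulVec_le_one w v)

theorem one_le_cutRank {a b : V} (ha : a ∈ A) (hb : b ∉ A) (hab : G.Adj a b) :
    1 ≤ cutRank G A := by
  classical
  refine le_trans ?_ (Matrix.eRank_submatrix_le _ (fun _ : Unit => ⟨a, ha⟩) fun _ : Unit => ⟨b, hb⟩)
  have hone : (((G.adjMatrix (ZMod 2)).submatrix (Subtype.val : A → V)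
      (Subtype.val : (Aᶜ : Set V) → V)).submatrix (fun _ : Unit => ⟨a, ha⟩)
      fun _ : Unit => ⟨b, hb⟩) = 1 := by
    ext
    simp [hab]
  rw [hone, Matrix.eRank_one]
  simp

end CutFunctions

namespace BranchDecomposition

variable {V : Type u} {G : SimpleGraph V} {f : Set V → ℕ∞} (D : BranchDecomposition V)

theorem width_le_one (h : ∀ x y, D.tree.Adj x y → f (D.side x y) ≤ 1) : D.width f ≤ 1 :=
  iSup_le fun x => iSup₂_le fun y hxy => h x y hxy

theorem exists_side_eq_singleton [Nontrivial V] (v : V) :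
    ∃ x y, D.tree.Adj x y ∧ D.side x y = {v} := by
  let leaf (u : V) : D.Node := D.leafEquiv.symm u
  have hleaf : leaf.Injective := Subtype.val_injective.comp D.leafEquiv.symm.injective
  have : Nontrivial D.Node := hleaf.nontrivial
  obtain ⟨y, hxy⟩ := D.isTree.connected.preconnected.exists_adj_of_nontrivial (leaf v)
  refine ⟨leaf v, y, hxy, Set.eq_singleton_iff_unique_mem.2 ⟨.refl _, ?_⟩⟩
  intro u (hu : (D.tree.deleteEdges {s(leaf v, y)}).Reachable (leaf v) (leaf u))
  have hisolated (z : D.Node) : ¬ (D.tree.deleteEdges {s(leaf v, y)}).Adj (leaf v) z := by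
    intro hz
    obtain rfl := Set.encard_le_one_iff.1 (D.leafEquiv.symm v).2 z y hz.1 hxy
    exact (SimpleGraph.deleteEdges_adj.1 hz).2 rfl
  obtain ⟨p⟩ := hu
  generalize hq : leaf u = q at p
  cases p with
  | nil => exact hleaf hq
  | cons hadj _ => exact absurd hadj (hisolated _)

theorem one_le_width (hG : G ≠ ⊥) (hf : ∀ A, ∀ a ∈ A, ∀ b ∉ A, G.Adj a b → 1 ≤ f A) :
    1 ≤ D.width f := by
  obtain ⟨a, b, hab⟩ := SimpleGraph.ne_bot_iff_exists_adj.1 hG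
  have : Nontrivial V := ⟨a, b, hab.ne⟩
  obtain ⟨x, y, hxy, hside⟩ := D.exists_side_eq_singleton a
  have hone : 1 ≤ f (D.side x y) := hf _ a (hside ▸ rfl) b (hside ▸ hab.ne') hab
  exact hone.trans (le_iSup_of_le x (le_iSup₂_of_le y hxy le_rfl))

end BranchDecomposition

theorem one_le_smWidth {V : Type u} {G : SimpleGraph V} (hG : G ≠ ⊥) : 1 ≤ smWidth G :=
  le_iInf fun D => D.one_le_width hG fun _ _ ha _ hb hab => one_le_splitMatchingCut ha hb hab

section HierarchyWidth

variable {V : Type u} {G : SimpleGraph V}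

theorem exists_branchDecomposition_isBicliqueBetween
    (h : Hierarchy (fun A => IsBicliqueBetween G A Aᶜ) Set.univ) :
    ∃ D : BranchDecomposition V,
      ∀ x y, D.tree.Adj x y → IsBicliqueBetween G (D.side x y) (D.side x y)ᶜ := by
  obtain ⟨D, hD⟩ :=
    h.exists_branchDecomposition fun v => .of_subsingleton_left Set.subsingleton_singleton
  refine ⟨D, fun x y hxy => (hD x y hxy).elim id fun h => ?_⟩
  rw [compl_compl] at h
  exact h.symm

theorem smWidth_le_one_of_hierarchy
    (h : Hierarchy (fun A => IsBicliqueBetween G A Aᶜ) Set.univ) : smWidth G ≤ 1 := by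
  obtain ⟨D, hD⟩ := exists_branchDecomposition_isBicliqueBetween h
  exact (iInf_le _ D).trans (D.width_le_one fun x y hxy => (hD x y hxy).splitMatchingCut_le_one)

end HierarchyWidth

theorem mainTheorem8 {V : Type u} [Finite V] [Nonempty V] (G : SimpleGraph V) :
    (IsCograph G ↔ cliqueWidth G ≤ 2) ∧
    (IsCograph G → smWidth G ≤ 1 ∧ (G ≠ ⊥ → smWidth G = 1)) ∧
    (IsDistanceHereditary G →
      cliqueWidth G ≤ 3 ∧
      smWidth G ≤ 1 ∧ (G ≠ ⊥ → smWidth G = 1) ∧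
      ∃ D : BranchDecomposition V,
        D.width (cutRank G) ≤ 1 ∧ (G ≠ ⊥ → D.width (cutRank G) = 1) ∧
        ∀ x y, D.tree.Adj x y → 2 ≤ (D.side x y).encard → 2 ≤ (D.side x y)ᶜ.encard →
          IsSplit G (D.side x y)) := by
  refine ⟨⟨IsCograph.cliqueWidth_le_two, IsCograph.of_cliqueWidth_le_two⟩, fun h => ?_, fun h => ?_⟩
  · have hsm : smWidth G ≤ 1 :=
      smWidth_le_one_of_hierarchy (h.hierarchy.mono fun _ _ => IsModule.isBicliqueBetween)
    exact ⟨hsm, fun hG => hsm.antisymm (one_le_smWidth hG)⟩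
  · have hsm : smWidth G ≤ 1 := smWidth_le_one_of_hierarchy h.hierarchy
    obtain ⟨D, hD⟩ := exists_branchDecomposition_isBicliqueBetween h.hierarchy
    have hrank : D.width (cutRank G) ≤ 1 :=
      D.width_le_one fun x y hxy => (hD x y hxy).cutRank_le_one
    refine ⟨h.cliqueWidth_le_three, hsm, fun hG => hsm.antisymm (one_le_smWidth hG), D, hrank,
      fun hG => hrank.antisymm ?_, fun x y hxy hside hcompl => ?_⟩
    · exact D.one_le_width hG fun _ _ ha _ hb hab => one_le_cutRank ha hb hab
    · exact isSplit_iff_isBicliqueBetween.2 ⟨two_le_encard_iff_nontrivial.1 hside,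
        two_le_encard_iff_nontrivial.1 hcompl, hD x y hxy⟩
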